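/- Let $\Xi=(\xi_0,\dots,\xi_{N+2})$ be a $2$-open knot vector on $[0,1]$, i.e. $0=\xi_0=\xi_1=\xi_2<\xi_3\le\dots\le\xi_{N-1}<\xi_N=\xi_{N+1}=\xi_{N+2}=1$. Let $\widehat h$ be its largest knot span, let $\widehat h_{\min}$ be its smallest non-empty knot span, and let $S_{2,\Xi}$ be the span of the $N$ quadratic B-splines over $\Xi$ on $(0,1)$ given by the Cox--de Boor recursion. Let $H^2_0(0,1)$ be the closure of $C_0^\infty(0,1)$ in the $H^2(0,1)$-norm, and write $|v|_{H^2(0,1)}=\|v''\|_{L^2(0,1)}$. For every $C_Q>0$ there is a constant $C>0$, depending only on $C_Q$, such that the following holds for every such $\Xi$ with $\widehat h\le\frac14$, $\widehat h_{\min}\ge C_Q\,\widehat h$ and $S_{2,\Xi}\subset H^2(0,1)$. There is a linear projector $\Pi:H^2_0(0,1)\to S_{2,\Xi}\cap H^2_0(0,1)$ (that is, $\Pi$ is linear with values in $S_{2,\Xi}\cap H^2_0(0,1)$, and $\Pi s=s$ for all $s\in S_{2,\Xi}\cap H^2_0(0,1)$) satisfying, for all $v\in H^2_0(0,1)$, $$|\Pi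 v|_{H^2(0,1)}^2+|v-\Pi v|_{H^2(0,1)}^2\le C\,|v|_{H^2(0,1)}^2$$ and $$\|v-\Pi v\|_{L^2(0,1)}^2\le C\,\widehat h^4\,|v|_{H^2(0,1)}^2 ,$$ that is, $\|v-\Pi v\|_{L^2(0,1)}\lesssim\widehat h^2|v|_{H^2(0,1)}$; since $\widehat h\le\frac14$, this in particular gives $\|v-\Pi v\|_{L^2(0,1)}^2\le C\,\widehat h^2\,|v|_{H^2(0,1)}^2$. -/

import Mathlib

open MeasureTheory Set
open scoped Distributions

noncomputable section

namespace UnitInterval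

/-! ### Sobolev spaces on the open interval `(0,1)` -/

/-- The open interval `(0,1)`. -/
def Omega : TopologicalSpace.Opens ℝ := ⟨Ioo 0 1, isOpen_Ioo⟩

/-- Lebesgue measure on `(0,1)`. -/
abbrev mu : Measure ℝ := volume.restrict (Ioo (0 : ℝ) 1)

/-- The real Hilbert space `L²(0,1)`. -/
abbrev L2 : Type := Lp ℝ 2 mu

/-- `g ∈ L²(0,1)` is a weak derivative of order `k` of `u ∈ L²(0,1)`:
`∫ u φ⁽ᵏ⁾ = (-1)ᵏ ∫ g φ` for all smooth `φ` with compact support in `(0,1)`. -/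
def HasWeakDeriv (k : ℕ) (u g : L2) : Prop :=
  ∀ φ : 𝓓(Omega, ℝ),
    ∫ x, u x * iteratedDeriv k φ x ∂mu = (-1) ^ k * ∫ x, g x * φ x ∂mu

open scoped Classical in
/-- The weak derivative of order `k` of `u` (which is unique, see `HasWeakDeriv.unique`);
the value is `0` if there is none in `L²(0,1)`. -/
def weakDeriv (k : ℕ) (u : L2) : L2 :=
  if h : ∃ g, HasWeakDeriv k u g then h.choose else 0

lemma memLp_iteratedDeriv (k : ℕ) (φ : 𝓓(Omega, ℝ)) : MemLp (iteratedDeriv k φ) 2 mu := by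
  have h1 : ContDiff ℝ (⊤ : ℕ∞) φ := φ.contDiff
  have h2 : Continuous (iteratedDeriv k φ) :=
    h1.continuous_iteratedDeriv k (by exact_mod_cast le_top)
  have h3 : HasCompactSupport (iteratedDeriv k φ) := by
    rw [iteratedDeriv_eq_iterate]
    clear h1 h2
    induction k with
    | zero => simpa using φ.hasCompactSupport
    | succ k ih => rw [Function.iterate_succ_apply']; exact ih.deriv
  exact (h2.memLp_of_hasCompactSupport h3).restrict _

lemma integrable_mul_iteratedDeriv (u : L2) (k : ℕ) (φ : 𝓓(Omega, ℝ)) :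
    Integrable (fun x => u x * iteratedDeriv k φ x) mu :=
  (Lp.memLp u).integrable_mul (memLp_iteratedDeriv k φ)

lemma integrable_mul_test (u : L2) (φ : 𝓓(Omega, ℝ)) :
    Integrable (fun x => u x * φ x) mu := by
  simpa using integrable_mul_iteratedDeriv u 0 φ

lemma integral_add_mul (u v : L2) (k : ℕ) (φ : 𝓓(Omega, ℝ)) :
    ∫ x, (u + v : L2) x * iteratedDeriv k φ x ∂mu
      = ∫ x, u x * iteratedDeriv k φ x ∂mu + ∫ x, v x * iteratedDeriv k φ x ∂mu := by
  rw [← integral_add (integrable_mul_iteratedDeriv u k φ) (integrable_mul_iteratedDeriv v k φ)]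
  refine integral_congr_ae ?_
  filter_upwards [Lp.coeFn_add u v] with x hx
  rw [hx, Pi.add_apply, add_mul]

lemma integral_smul_mul (c : ℝ) (u : L2) (k : ℕ) (φ : 𝓓(Omega, ℝ)) :
    ∫ x, (c • u : L2) x * iteratedDeriv k φ x ∂mu
      = c * ∫ x, u x * iteratedDeriv k φ x ∂mu := by
  rw [← integral_const_mul]
  refine integral_congr_ae ?_
  filter_upwards [Lp.coeFn_smul c u] with x hx
  rw [hx, Pi.smul_apply, smul_eq_mul, mul_assoc]

lemma HasWeakDeriv.add {k : ℕ} {u v f g : L2} (hu : HasWeakDeriv k u f)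
    (hv : HasWeakDeriv k v g) : HasWeakDeriv k (u + v) (f + g) := by
  intro φ
  have h := integral_add_mul f g 0 φ
  simp only [iteratedDeriv_zero] at h
  rw [integral_add_mul, hu φ, hv φ, h, mul_add]

lemma HasWeakDeriv.smul {k : ℕ} {u f : L2} (c : ℝ) (hu : HasWeakDeriv k u f) :
    HasWeakDeriv k (c • u) (c • f) := by
  intro φ
  have h := integral_smul_mul c f 0 φ
  simp only [iteratedDeriv_zero] at h
  rw [integral_smul_mul, hu φ, h]
  ring

lemma HasWeakDeriv.unique {k : ℕ} {u f g : L2} (hf : HasWeakDeriv k u f)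
    (hg : HasWeakDeriv k u g) : f = g := by
  have key : ∀ φ : 𝓓(Omega, ℝ), ∫ x, (f - g : L2) x * φ x ∂mu = 0 := by
    intro φ
    have h1 : ∫ x, f x * φ x ∂mu = ∫ x, g x * φ x ∂mu := by
      have h := (hf φ).symm.trans (hg φ)
      exact mul_left_cancel₀ (pow_ne_zero k (by norm_num)) h
    have h2 : ∫ x, (f - g : L2) x * φ x ∂mu
        = ∫ x, f x * φ x ∂mu - ∫ x, g x * φ x ∂mu := by
      rw [← integral_sub (integrable_mul_test f φ) (integrable_mul_test g φ)]
      refine integral_congr_ae ?_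
      filter_upwards [Lp.coeFn_sub f g] with x hx
      rw [hx, Pi.sub_apply, sub_mul]
    rw [h2, h1, sub_self]
  have hloc : LocallyIntegrableOn (f - g : L2) (Ioo (0 : ℝ) 1) volume :=
    IntegrableOn.locallyIntegrableOn ((Lp.memLp (f - g)).integrable (by norm_num))
  have h0 := isOpen_Ioo.ae_eq_zero_of_integral_contDiff_smul_eq_zero hloc (by
    intro (φ : ℝ → ℝ) h1 h2 h3
    have h : ∫ x, (f - g : L2) x * φ x ∂mu = 0 := key (⟨φ, h1, h2, h3⟩ : 𝓓(Omega, ℝ))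
    have h' : ∫ x in Ioo (0 : ℝ) 1, φ x • (f - g : L2) x = 0 := by
      refine Eq.trans (integral_congr_ae ?_) h
      filter_upwards with x
      exact mul_comm _ _
    refine Eq.trans (setIntegral_eq_integral_of_forall_compl_eq_zero fun x hx => ?_).symm h'
    have : φ x = 0 := image_eq_zero_of_notMem_tsupport fun hh => hx (h3 hh)
    simp [this])
  have h1 : (f - g : L2) =ᵐ[mu] 0 := by
    rw [Filter.EventuallyEq, ae_restrict_iff' measurableSet_Ioo]
    filter_upwards [h0] with x hx hx' using hx hx'
  exact sub_eq_zero.1 ((Lp.eq_zero_iff_ae_eq_zero).2 h1)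

lemma HasWeakDeriv.weakDeriv_eq {k : ℕ} {u g : L2} (h : HasWeakDeriv k u g) :
    weakDeriv k u = g := by
  have h' : ∃ g, HasWeakDeriv k u g := ⟨g, h⟩
  rw [weakDeriv, dif_pos h']
  exact h'.choose_spec.unique h

/-- The Sobolev space `Hʳ(0,1)`: all `u ∈ L²(0,1)` whose weak derivatives of order at most `r`
exist in `L²(0,1)`. -/
def sobolev (r : ℕ) : Submodule ℝ L2 where
  carrier := {u | ∀ k ≤ r, ∃ g, HasWeakDeriv k u g}
  zero_mem' := fun k _ => ⟨(0 : ℝ) • 0, by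
    intro φ
    have h1 := integral_smul_mul 0 0 k φ
    have h2 := integral_smul_mul 0 0 0 φ
    simp only [iteratedDeriv_zero, zero_mul] at h1 h2
    rw [h2, mul_zero, ← h1, zero_smul]⟩
  add_mem' := fun hu hv k hk => by
    obtain ⟨f, hf⟩ := hu k hk
    obtain ⟨g, hg⟩ := hv k hk
    exact ⟨f + g, hf.add hg⟩
  smul_mem' := fun c _ hu k hk => by
    obtain ⟨f, hf⟩ := hu k hk
    exact ⟨c • f, hf.smul c⟩

/-- The seminorm `|u|_{Hʳ(0,1)} = ‖u⁽ʳ⁾‖_{L²(0,1)}`. -/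
def sobolevSeminorm (r : ℕ) (u : L2) : ℝ := ‖weakDeriv r u‖

/-- The norm `‖u‖_{Hʳ(0,1)} = (∑_{k ≤ r} |u|_{Hᵏ(0,1)}²)^{1/2}`. -/
def sobolevNorm (r : ℕ) (u : L2) : ℝ :=
  √(∑ k : Fin (r + 1), sobolevSeminorm k u ^ 2)

lemma weakDeriv_add {r : ℕ} {u v : L2} (hu : u ∈ sobolev r) (hv : v ∈ sobolev r) (k : ℕ)
    (hk : k ≤ r) : weakDeriv k (u + v) = weakDeriv k u + weakDeriv k v := by
  obtain ⟨f, hf⟩ := hu k hk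
  obtain ⟨g, hg⟩ := hv k hk
  rw [hf.weakDeriv_eq, hg.weakDeriv_eq, (hf.add hg).weakDeriv_eq]

lemma weakDeriv_smul {r : ℕ} {u : L2} (c : ℝ) (hu : u ∈ sobolev r) (k : ℕ)
    (hk : k ≤ r) : weakDeriv k (c • u) = c • weakDeriv k u := by
  obtain ⟨f, hf⟩ := hu k hk
  rw [hf.weakDeriv_eq, (hf.smul c).weakDeriv_eq]

lemma sobolevNorm_eq (r : ℕ) (u : L2) :
    sobolevNorm r u = ‖WithLp.toLp 2 (fun k : Fin (r + 1) => weakDeriv k u)‖ := by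
  rw [PiLp.norm_eq_of_L2]
  rfl

lemma sobolevNorm_add_le {r : ℕ} {u v : L2} (hu : u ∈ sobolev r) (hv : v ∈ sobolev r) :
    sobolevNorm r (u + v) ≤ sobolevNorm r u + sobolevNorm r v := by
  have h : (fun k : Fin (r + 1) => weakDeriv k (u + v))
      = (fun k : Fin (r + 1) => weakDeriv k u) + (fun k : Fin (r + 1) => weakDeriv k v) :=
    funext fun k => weakDeriv_add hu hv k (Nat.lt_succ_iff.1 k.2)
  rw [sobolevNorm_eq, sobolevNorm_eq, sobolevNorm_eq, h, WithLp.toLp_add]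
  exact norm_add_le _ _

lemma sobolevNorm_smul {r : ℕ} {u : L2} (c : ℝ) (hu : u ∈ sobolev r) :
    sobolevNorm r (c • u) = |c| * sobolevNorm r u := by
  have h : (fun k : Fin (r + 1) => weakDeriv k (c • u))
      = c • (fun k : Fin (r + 1) => weakDeriv k u) :=
    funext fun k => weakDeriv_smul c hu k (Nat.lt_succ_iff.1 k.2)
  rw [sobolevNorm_eq, sobolevNorm_eq, h, WithLp.toLp_smul, norm_smul, Real.norm_eq_abs]

/-- The (classes of the) functions in `C₀^∞(0,1)`, as elements of `L²(0,1)`. -/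
def testClasses : Submodule ℝ L2 where
  carrier := {w | ∃ φ : 𝓓(Omega, ℝ), w =ᵐ[mu] φ}
  zero_mem' := ⟨0, Lp.coeFn_zero ℝ 2 mu⟩
  add_mem' := by
    rintro u v ⟨φ, hφ⟩ ⟨ψ, hψ⟩
    exact ⟨φ + ψ, (Lp.coeFn_add u v).trans (hφ.add hψ)⟩
  smul_mem' := by
    rintro c u ⟨φ, hφ⟩
    exact ⟨c • φ, (Lp.coeFn_smul c u).trans (hφ.const_smul c)⟩

lemma integral_mul_iteratedDeriv (k : ℕ) (φ ψ : ℝ → ℝ)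
    (hφ : ContDiff ℝ (⊤ : ℕ∞) φ) (hψ : ContDiff ℝ (⊤ : ℕ∞) ψ)
    (hφc : HasCompactSupport φ) (hψc : HasCompactSupport ψ) :
    ∫ x, φ x * iteratedDeriv k ψ x = (-1) ^ k * ∫ x, iteratedDeriv k φ x * ψ x := by
  induction k generalizing φ ψ with
  | zero => simp
  | succ k ih =>
    have hφ1 : ContDiff ℝ (⊤ : ℕ∞) (deriv φ) := (contDiff_infty_iff_deriv.1 hφ).2
    have hψ1 : ContDiff ℝ (⊤ : ℕ∞) (deriv ψ) := (contDiff_infty_iff_deriv.1 hψ).2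
    have hpk : ContDiff ℝ (⊤ : ℕ∞) (iteratedDeriv k φ) := by
      rw [iteratedDeriv_eq_iterate]; exact hφ.iterate_deriv k
    have hpkc : HasCompactSupport (iteratedDeriv k φ) := by
      rw [iteratedDeriv_eq_iterate]
      clear ih hφ1 hpk
      induction k with
      | zero => simpa using hφc
      | succ k ih => rw [Function.iterate_succ_apply']; exact ih.deriv
    have hpk1 : Continuous (deriv (iteratedDeriv k φ)) :=
      ((contDiff_infty_iff_deriv.1 hpk).2).continuous
    rw [iteratedDeriv_succ', ih φ (deriv ψ) hφ hψ1 hφc hψc.deriv, iteratedDeriv_succ]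
    rw [integral_mul_deriv_eq_deriv_mul_of_integrable (u := iteratedDeriv k φ) (v := ψ)
      (u' := deriv (iteratedDeriv k φ)) (v' := deriv ψ)
      (fun x _ => (hpk.differentiable (by simp) x).hasDerivAt)
      (fun x _ => (hψ.differentiable (by simp) x).hasDerivAt)
      ((hpk.continuous.mul hψ1.continuous).integrable_of_hasCompactSupport
        hpkc.mul_right)
      ((hpk1.mul hψ.continuous).integrable_of_hasCompactSupport hpkc.deriv.mul_right)
      ((hpk.continuous.mul hψ.continuous).integrable_of_hasCompactSupport hpkc.mul_right)]
    ring

lemma setIntegral_mul_of_tsupport (f g : ℝ → ℝ) (hg : ∀ x ∉ Ioo (0 : ℝ) 1, g x = 0) :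
    ∫ x, f x * g x ∂mu = ∫ x, f x * g x :=
  setIntegral_eq_integral_of_forall_compl_eq_zero fun x hx => by simp [hg x hx]

lemma testClasses_le_sobolev (r : ℕ) : testClasses ≤ sobolev r := by
  rintro w ⟨φ, hφ⟩ k -
  refine ⟨(memLp_iteratedDeriv k φ).toLp _, fun ψ => ?_⟩
  have hz : ∀ (ρ : 𝓓(Omega, ℝ)), ∀ x ∉ Ioo (0 : ℝ) 1, ρ x = 0 := fun ρ x hx =>
    image_eq_zero_of_notMem_tsupport fun hh => hx (ρ.tsupport_subset hh)
  have e1 : ∫ x, w x * iteratedDeriv k ψ x ∂mu = ∫ x, φ x * iteratedDeriv k ψ x := by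
    calc ∫ x, w x * iteratedDeriv k ψ x ∂mu = ∫ x, iteratedDeriv k ψ x * φ x ∂mu := by
          refine integral_congr_ae ?_
          filter_upwards [hφ] with x hx
          rw [hx, mul_comm]
      _ = ∫ x, iteratedDeriv k ψ x * φ x := setIntegral_mul_of_tsupport _ _ (hz φ)
      _ = _ := by simp only [mul_comm]
  have e2 : ∫ x, ((memLp_iteratedDeriv k φ).toLp _ : L2) x * ψ x ∂mu
      = ∫ x, iteratedDeriv k φ x * ψ x := by
    rw [← setIntegral_mul_of_tsupport _ _ (hz ψ)]
    refine integral_congr_ae ?_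
    filter_upwards [(memLp_iteratedDeriv k φ).coeFn_toLp] with x hx
    rw [hx]
  rw [e1, e2]
  exact integral_mul_iteratedDeriv k φ ψ φ.contDiff ψ.contDiff φ.hasCompactSupport
    ψ.hasCompactSupport

/-- The space `H₀ʳ(0,1)`: the closure of `C₀^∞(0,1)` in `Hʳ(0,1)` with respect to the norm
`‖·‖_{Hʳ(0,1)}`. -/
def sobolevZero (r : ℕ) : Submodule ℝ L2 where
  carrier := {u | u ∈ sobolev r ∧ ∀ ε > 0, ∃ w ∈ testClasses, sobolevNorm r (u - w) < ε}
  zero_mem' := ⟨zero_mem _, fun ε hε => ⟨0, zero_mem _, by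
    have h := sobolevNorm_smul (r := r) 0 (zero_mem (sobolev r))
    rw [zero_smul, abs_zero, zero_mul] at h
    rw [sub_zero, h]
    exact hε⟩⟩
  add_mem' := by
    rintro u v ⟨hu, hu'⟩ ⟨hv, hv'⟩
    refine ⟨add_mem hu hv, fun ε hε => ?_⟩
    obtain ⟨w, hw, h1⟩ := hu' (ε / 2) (half_pos hε)
    obtain ⟨z, hz, h2⟩ := hv' (ε / 2) (half_pos hε)
    refine ⟨w + z, add_mem hw hz, ?_⟩
    rw [add_sub_add_comm]
    have h := sobolevNorm_add_le (sub_mem hu (testClasses_le_sobolev r hw))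
      (sub_mem hv (testClasses_le_sobolev r hz))
    linarith
  smul_mem' := by
    rintro c u ⟨hu, hu'⟩
    refine ⟨Submodule.smul_mem _ c hu, fun ε hε => ?_⟩
    obtain ⟨w, hw, h1⟩ := hu' (ε / (|c| + 1)) (by positivity)
    refine ⟨c • w, Submodule.smul_mem _ c hw, ?_⟩
    rw [← smul_sub, sobolevNorm_smul c (sub_mem hu (testClasses_le_sobolev r hw))]
    have h0 : 0 ≤ sobolevNorm r (u - w) := Real.sqrt_nonneg _
    rw [lt_div_iff₀ (by positivity)] at h1
    nlinarith

/-! ### Spline spaces -/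

/-- `ξ 0, …, ξ (N + p)` is a `p`-open knot vector on `[0,1]`:
`0 = ξ₀ = … = ξₚ < ξₚ₊₁ ≤ … ≤ ξ_{N-1} < ξ_N = … = ξ_{N+p} = 1`.
Only the values `ξ 0, …, ξ (N + p)` matter. -/
structure IsOpenKnotVector (p N : ℕ) (ξ : ℕ → ℝ) : Prop where
  left : ∀ i ≤ p, ξ i = 0
  right : ∀ i, N ≤ i → i ≤ N + p → ξ i = 1
  mono : ∀ i < N + p, ξ i ≤ ξ (i + 1)
  left_lt : ξ p < ξ (p + 1)
  lt_right : ξ (N - 1) < ξ N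

/-- The B-splines of degree `q` over the knots `ξ` by the Cox-de Boor recursion, with the usual
convention that a quotient with denominator zero is zero. The `i`-th one uses the knots
`ξ i, …, ξ (i + q + 1)`. -/
def bspline (ξ : ℕ → ℝ) : ℕ → ℕ → ℝ → ℝ
  | 0, i, x => if ξ i ≤ x ∧ x < ξ (i + 1) then 1 else 0
  | q + 1, i, x =>
      (x - ξ i) / (ξ (i + q + 1) - ξ i) * bspline ξ q i x
        + (ξ (i + q + 2) - x) / (ξ (i + q + 2) - ξ (i + 1)) * bspline ξ q (i + 1) x

/-- The spline space `S_{p,Ξ}`: the span of the `N` B-splines of degree `p` on `(0,1)`, as a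
space of elements of `L²(0,1)`. -/
def splineSpace (p N : ℕ) (ξ : ℕ → ℝ) : Submodule ℝ L2 where
  carrier := {u | ∃ f ∈ Submodule.span ℝ (range fun i : Fin N => bspline ξ p i), u =ᵐ[mu] f}
  zero_mem' := ⟨0, zero_mem _, Lp.coeFn_zero ℝ 2 mu⟩
  add_mem' := by
    rintro u v ⟨f, hf, hu⟩ ⟨g, hg, hv⟩
    exact ⟨f + g, add_mem hf hg, (Lp.coeFn_add u v).trans (hu.add hv)⟩
  smul_mem' := by
    rintro c u ⟨f, hf, hu⟩
    exact ⟨c • f, Submodule.smul_mem _ c hf, (Lp.coeFn_smul c u).trans (hu.const_smul c)⟩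

/-- The largest knot span of `ξ 0, …, ξ (N + p)`. -/
def maxKnotSpan (p N : ℕ) (ξ : ℕ → ℝ) : ℝ :=
  sSup {d | ∃ i < N + p, d = ξ (i + 1) - ξ i}

/-- The smallest non-empty knot span of `ξ 0, …, ξ (N + p)`. -/
def minKnotSpan (p N : ℕ) (ξ : ℕ → ℝ) : ℝ :=
  sInf {d | ∃ i < N + p, ξ i < ξ (i + 1) ∧ d = ξ (i + 1) - ξ i}

end UnitInterval

end

open UnitInterval

noncomputable section

namespace UnitInterval

/-! ### Iterated primitives of square integrable functions -/

/-! A function `v ∈ H₀²(0,1)` is handled through its second derivative `g`. The second derivatives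
of test functions are dense in the orthogonal complement of the affine functions, so `v ↦ v''`
identifies `H₀²(0,1)` with the `g ∈ L²(0,1)` whose moments of order `0` and `1` vanish, and `v =
prim₂ g` pointwise (`eq_primL₂_of_mem_sobolevZero`, `primL₂_mem_sobolevZero`). Point values of `v`
then make sense, and Cauchy–Schwarz bounds the first order Taylor error by `|x - y|^{3/2}` times the
`L²`-norm of `g` nearby (`sq_prim₂_sub_le`).

The inclusion of the spline space in `H²(0,1)` forces simple interior knots: a B-spline over a
double interior knot has a kink (`knot_lt_succ`). Splines whose two first and two last coefficients
vanish are then exactly twice integrated step functions with vanishing moments, hence lie in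
`H₀²(0,1)`.

The projector is a quasi-interpolant. The `i`-th B-spline coefficient of a spline is the polar form
of its quadratic piece on the middle knot span `[a,b]`, evaluated at `(a,b)`; with `m` the midpoint
this equals `2 v(m) - (v(a) + v(b)) / 2`, which is used as coefficient functional for every `v`. The
boundary coefficients are set to zero, as they are for each spline in `H₀²(0,1)`. Hence splines are
reproduced (`splineCoef_eq`).

For the estimates, the Taylor polynomial of `v` at the left end of a knot span is a spline with
coefficients given by its values at the points `greville ξ i`. The coefficients of the
quasi-interpolant differ from these by `O(h^{3/2})` times the local `L²`-norm of `g`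
(`sq_splineCoef_sub_taylor_le`), also at the boundary, where `v` and `v'` vanish. Since B-splines
are a partition of unity, this gives the local error bound; dividing second differences of
coefficients by squared span lengths, comparable with `h²`, gives local stability. Each span lies in
at most three patches, so the local bounds can be summed. -/

/-- The extension by zero of `g ∈ L²(0,1)` to the real line. -/
def extZero (g : L2) : ℝ → ℝ := indicator (Ioo (0 : ℝ) 1) g

lemma memLp_extZero (g : L2) : MemLp (extZero g) 2 volume :=
  (memLp_indicator_iff_restrict measurableSet_Ioo).2 (Lp.memLp g)

lemma integrable_extZero (g : L2) : Integrable (extZero g) volume :=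
  (integrable_indicator_iff measurableSet_Ioo).2 ((Lp.memLp g).integrable (by norm_num))

lemma integrable_extZero_sq (g : L2) : Integrable (fun t => extZero g t ^ 2) volume :=
  (memLp_extZero g).integrable_sq

lemma extZero_ae_eq (g : L2) : extZero g =ᵐ[mu] g :=
  indicator_ae_eq_restrict measurableSet_Ioo

lemma extZero_congr {g : L2} {f : ℝ → ℝ} (h : g =ᵐ[mu] f) :
    extZero g =ᵐ[volume] indicator (Ioo (0 : ℝ) 1) f := by
  rw [Filter.EventuallyEq, ae_restrict_iff' measurableSet_Ioo] at h
  filter_upwards [h] with x hx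
  by_cases hx' : x ∈ Ioo (0 : ℝ) 1
  · simp [extZero, hx', hx hx']
  · simp [extZero, hx']

lemma extZero_add (g h : L2) :
    extZero (g + h) =ᵐ[volume] fun t => extZero g t + extZero h t := by
  filter_upwards [extZero_congr (Lp.coeFn_add g h)] with x hx
  rw [hx]
  exact congrFun (indicator_add _ _ _) x

lemma extZero_smul (c : ℝ) (g : L2) :
    extZero (c • g) =ᵐ[volume] fun t => c * extZero g t := by
  filter_upwards [extZero_congr (Lp.coeFn_smul c g)] with x hx
  rw [hx]
  exact congrFun (indicator_const_smul _ c _) x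

lemma intervalIntegrable_extZero (g : L2) (a b : ℝ) :
    IntervalIntegrable (extZero g) volume a b :=
  (integrable_extZero g).intervalIntegrable

lemma intervalIntegrable_mul_extZero {f : ℝ → ℝ} (hf : Continuous f) (g : L2) (a b : ℝ) :
    IntervalIntegrable (fun t => f t * extZero g t) volume a b :=
  (intervalIntegrable_extZero g a b).continuousOn_mul hf.continuousOn

lemma intervalIntegrable_id_mul_extZero (g : L2) (a b : ℝ) :
    IntervalIntegrable (fun t => t * extZero g t) volume a b :=
  intervalIntegrable_mul_extZero continuous_id g a b

lemma intervalIntegrable_extZero_sq (g : L2) (a b : ℝ) :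
    IntervalIntegrable (fun t => extZero g t ^ 2) volume a b :=
  (integrable_extZero_sq g).intervalIntegrable

/-! ### Norms, local energies and the Cauchy–Schwarz inequality. -/

lemma norm_sq_eq_integral (g : L2) : ‖g‖ ^ 2 = ∫ x, g x ^ 2 ∂mu := by
  rw [← real_inner_self_eq_norm_sq, L2.inner_def]
  refine integral_congr_ae ?_
  filter_upwards with x
  simp [pow_two]

lemma norm_sq_eq_intervalIntegral (g : L2) : ‖g‖ ^ 2 = ∫ t in (0 : ℝ)..1, extZero g t ^ 2 := by
  rw [norm_sq_eq_integral, intervalIntegral.integral_of_le zero_le_one,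
    integral_Ioc_eq_integral_Ioo]
  refine integral_congr_ae ?_
  filter_upwards [extZero_ae_eq g] with x hx
  rw [hx]

/-- The squared `L²`-norm of `g` on `(a,b)`. -/
def energy (g : L2) (a b : ℝ) : ℝ := ∫ t in a..b, extZero g t ^ 2

lemma energy_nonneg (g : L2) {a b : ℝ} (h : a ≤ b) : 0 ≤ energy g a b :=
  intervalIntegral.integral_nonneg h fun _ _ => sq_nonneg _

lemma energy_add (g : L2) (a b c : ℝ) : energy g a b + energy g b c = energy g a c :=
  intervalIntegral.integral_add_adjacent_intervals (intervalIntegrable_extZero_sq g a b)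
    (intervalIntegrable_extZero_sq g b c)

lemma energy_mono (g : L2) {a b c d : ℝ} (h1 : c ≤ a) (h3 : b ≤ d) :
    energy g a b ≤ energy g c d := by
  have e1 := energy_add g c a b
  have e2 := energy_add g c b d
  have n1 := energy_nonneg g h1
  have n2 := energy_nonneg g h3
  linarith

lemma energy_le (g : L2) {a b : ℝ} (h : a ≤ b) : energy g a b ≤ ‖g‖ ^ 2 := by
  rw [norm_sq_eq_integral]
  have h1 : ∫ x, g x ^ 2 ∂mu = ∫ t, extZero g t ^ 2 := by
    rw [← integral_indicator measurableSet_Ioo]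
    refine integral_congr_ae (Filter.Eventually.of_forall fun x => ?_)
    by_cases hx : x ∈ Ioo (0 : ℝ) 1 <;> simp [extZero, hx]
  rw [h1, energy, intervalIntegral.integral_of_le h]
  exact setIntegral_le_integral (integrable_extZero_sq g)
    (Filter.Eventually.of_forall fun _ => sq_nonneg _)

/-- Cauchy–Schwarz against the constant `1`, obtained by integrating the square of `|f|` minus its
mean. -/
lemma sq_integral_abs_le {f : ℝ → ℝ} {a b : ℝ} (hab : a ≤ b)
    (h1 : IntervalIntegrable f volume a b)
    (h2 : IntervalIntegrable (fun t => f t ^ 2) volume a b) :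
    (∫ t in a..b, |f t|) ^ 2 ≤ (b - a) * ∫ t in a..b, f t ^ 2 := by
  rcases hab.eq_or_lt with rfl | hab
  · simp
  set m := ∫ t in a..b, |f t|
  set q := ∫ t in a..b, f t ^ 2
  have hba : 0 < b - a := sub_pos.2 hab
  have key : 0 ≤ ∫ t in a..b, ((f t ^ 2 - 2 * (m / (b - a)) * |f t|) + (m / (b - a)) ^ 2) :=
    intervalIntegral.integral_nonneg hab.le fun t _ => by
      have := sq_nonneg (|f t| - m / (b - a))
      nlinarith [sq_abs (f t)]
  rw [intervalIntegral.integral_add (h2.sub (h1.abs.const_mul _)) (by simp),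
    intervalIntegral.integral_sub h2 (h1.abs.const_mul _),
    intervalIntegral.integral_const_mul, intervalIntegral.integral_const, smul_eq_mul] at key
  have e : q - 2 * (m / (b - a)) * m + (b - a) * (m / (b - a)) ^ 2 = q - m ^ 2 / (b - a) := by
    field_simp
    ring
  have : m ^ 2 / (b - a) ≤ q := by
    change 0 ≤ q - 2 * (m / (b - a)) * m + (b - a) * (m / (b - a)) ^ 2 at key
    linarith
  rw [div_le_iff₀ hba] at this
  linarith

/-- The primitive `x ↦ ∫₀ˣ g`. -/
def prim (g : L2) (x : ℝ) : ℝ := ∫ t in (0 : ℝ)..x, extZero g t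

/-- The second primitive `x ↦ ∫₀ˣ (x - t) g(t) dt`. -/
def prim₂ (g : L2) (x : ℝ) : ℝ := x * prim g x - ∫ t in (0 : ℝ)..x, t * extZero g t

@[simp] lemma prim_zero_right (g : L2) : prim g 0 = 0 := by simp [prim]

@[simp] lemma prim₂_zero_right (g : L2) : prim₂ g 0 = 0 := by simp [prim₂]

lemma prim_add (g h : L2) (x : ℝ) : prim (g + h) x = prim g x + prim h x := by
  rw [prim, prim, prim, ← intervalIntegral.integral_add (intervalIntegrable_extZero g _ _)
    (intervalIntegrable_extZero h _ _)]
  refine intervalIntegral.integral_congr_ae ?_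
  filter_upwards [extZero_add g h] with t ht _ using ht

lemma prim_smul (c : ℝ) (g : L2) (x : ℝ) : prim (c • g) x = c * prim g x := by
  rw [prim, prim, ← intervalIntegral.integral_const_mul]
  refine intervalIntegral.integral_congr_ae ?_
  filter_upwards [extZero_smul c g] with t ht _ using ht

lemma prim₂_add (g h : L2) (x : ℝ) : prim₂ (g + h) x = prim₂ g x + prim₂ h x := by
  have e : ∫ t in (0 : ℝ)..x, t * extZero (g + h) t
      = (∫ t in (0 : ℝ)..x, t * extZero g t) + ∫ t in (0 : ℝ)..x, t * extZero h t := by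
    rw [← intervalIntegral.integral_add
      (intervalIntegrable_id_mul_extZero g _ _)
      (intervalIntegrable_id_mul_extZero h _ _)]
    refine intervalIntegral.integral_congr_ae ?_
    filter_upwards [extZero_add g h] with t ht _
    rw [ht]
    ring
  rw [prim₂, prim₂, prim₂, e, prim_add]
  ring

lemma prim₂_smul (c : ℝ) (g : L2) (x : ℝ) : prim₂ (c • g) x = c * prim₂ g x := by
  have e : ∫ t in (0 : ℝ)..x, t * extZero (c • g) t
      = c * ∫ t in (0 : ℝ)..x, t * extZero g t := by
    rw [← intervalIntegral.integral_const_mul]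
    refine intervalIntegral.integral_congr_ae ?_
    filter_upwards [extZero_smul c g] with t ht _
    rw [ht]
    ring
  rw [prim₂, prim₂, e, prim_smul]
  ring

lemma prim_eq (g : L2) (x y : ℝ) : prim g x = prim g y + ∫ t in y..x, extZero g t :=
  (intervalIntegral.integral_add_adjacent_intervals (intervalIntegrable_extZero g 0 y)
    (intervalIntegrable_extZero g y x)).symm

/-- Taylor's formula with integral remainder; the base point `y` may lie on either side of `x`. -/
lemma prim₂_eq (g : L2) (x y : ℝ) :
    prim₂ g x = prim₂ g y + prim g y * (x - y) + ∫ t in y..x, (x - t) * extZero g t := by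
  have h1 := prim_eq g x y
  have h2 := intervalIntegral.integral_add_adjacent_intervals
    (intervalIntegrable_id_mul_extZero g 0 y)
    (intervalIntegrable_id_mul_extZero g y x)
  have h3 : ∫ t in y..x, (x - t) * extZero g t
      = x * (∫ t in y..x, extZero g t) - ∫ t in y..x, t * extZero g t := by
    rw [← intervalIntegral.integral_const_mul, ← intervalIntegral.integral_sub
      ((intervalIntegrable_extZero g y x).const_mul x)
      (intervalIntegrable_id_mul_extZero g y x)]
    simp only [sub_mul]
  rw [h3, prim₂, prim₂, ← h2, h1]
  ring

lemma abs_remainder_le (g : L2) {x y b : ℝ} (h : ∀ t ∈ uIcc y x, |x - t| ≤ b) :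
    (∫ t in y..x, (x - t) * extZero g t) ^ 2
      ≤ b ^ 2 * (∫ t in (min y x)..(max y x), |extZero g t|) ^ 2 := by
  have hb : 0 ≤ b := (abs_nonneg _).trans (h y left_mem_uIcc)
  rw [← mul_pow]
  refine sq_le_sq' ?_ ?_
  all_goals
    have h1 : |∫ t in y..x, (x - t) * extZero g t|
        ≤ b * ∫ t in (min y x)..(max y x), |extZero g t| := by
      rw [← intervalIntegral.integral_const_mul,
        intervalIntegral.integral_of_le (min_le_max (a := y) (b := x)),
        intervalIntegral.abs_integral_eq_abs_integral_uIoc, uIoc]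
      refine (abs_integral_le_integral_abs).trans (setIntegral_mono_on ?_ ?_
        measurableSet_Ioc fun t ht => ?_)
      · exact ((intervalIntegrable_iff_integrableOn_Ioc_of_le min_le_max).1
          (intervalIntegrable_mul_extZero (f := fun t => x - t) (by fun_prop) g _ _)).abs
      · exact ((intervalIntegrable_iff_integrableOn_Ioc_of_le min_le_max).1
          ((intervalIntegrable_extZero g _ _).abs.const_mul b))
      · rw [abs_mul]
        exact mul_le_mul_of_nonneg_right (h t (Ioc_subset_Icc_self ht)) (abs_nonneg _)
    have := abs_le.1 h1
    linarith

/-- Taylor's theorem of first order with `L²`-remainder. -/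
lemma sq_prim₂_sub_le (g : L2) {a b x y : ℝ} (hx : x ∈ Icc a b) (hy : y ∈ Icc a b) :
    (prim₂ g x - (prim₂ g y + prim g y * (x - y))) ^ 2 ≤ |x - y| ^ 3 * energy g a b := by
  rw [prim₂_eq g x y, add_sub_cancel_left]
  have hm : min y x ≤ max y x := min_le_max
  have hxy : max y x - min y x = |x - y| := by rw [max_sub_min_eq_abs']; exact abs_sub_comm _ _
  refine (abs_remainder_le g (b := |x - y|) fun t ht => ?_).trans ?_
  · exact abs_sub_right_of_mem_uIcc ht
  · have h1 := sq_integral_abs_le hm (intervalIntegrable_extZero g _ _)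
      (intervalIntegrable_extZero_sq g _ _)
    rw [hxy] at h1
    have h2 : energy g (min y x) (max y x) ≤ energy g a b :=
      energy_mono g (le_min hy.1 hx.1) (max_le hy.2 hx.2)
    calc _ ≤ |x - y| ^ 2 * (|x - y| * energy g (min y x) (max y x)) := by gcongr; exact h1
      _ ≤ |x - y| ^ 2 * (|x - y| * energy g a b) := by gcongr
      _ = _ := by ring

lemma sq_prim_le (g : L2) {x : ℝ} (hx : x ∈ Icc (0 : ℝ) 1) : prim g x ^ 2 ≤ ‖g‖ ^ 2 := by
  have h1 : |prim g x| ≤ ∫ t in (0 : ℝ)..x, |extZero g t| :=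
    intervalIntegral.abs_integral_le_integral_abs hx.1
  have h2 := sq_integral_abs_le hx.1 (intervalIntegrable_extZero g _ _)
      (intervalIntegrable_extZero_sq g _ _)
  have h3 : prim g x ^ 2 ≤ (∫ t in (0 : ℝ)..x, |extZero g t|) ^ 2 := by
    rw [← sq_abs]; gcongr
  have h4 := energy_nonneg g hx.1
  have h5 := energy_le g hx.1
  have h6 : (x - 0) * ∫ t in (0 : ℝ)..x, extZero g t ^ 2 ≤ energy g 0 x := by
    have : (x - 0) * energy g 0 x ≤ 1 * energy g 0 x :=
      mul_le_mul_of_nonneg_right (by linarith [hx.2]) h4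
    simpa [energy] using this
  linarith

lemma sq_prim₂_le (g : L2) {x : ℝ} (hx : x ∈ Icc (0 : ℝ) 1) : prim₂ g x ^ 2 ≤ ‖g‖ ^ 2 := by
  have h := sq_prim₂_sub_le g hx (⟨le_rfl, zero_le_one⟩ : (0 : ℝ) ∈ Icc (0 : ℝ) 1)
  simp only [prim₂_zero_right, prim_zero_right, zero_mul, add_zero, sub_zero] at h
  refine h.trans ?_
  have h1 : |x| ^ 3 ≤ 1 := pow_le_one₀ (abs_nonneg _) (abs_le.2 ⟨by linarith [hx.1], hx.2⟩)
  calc _ ≤ 1 * energy g 0 1 := by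
        gcongr
        exact energy_nonneg g zero_le_one
    _ ≤ _ := by rw [one_mul]; exact energy_le g zero_le_one

lemma abs_prim_le (g : L2) {x : ℝ} (hx : x ∈ Icc (0 : ℝ) 1) : |prim g x| ≤ ‖g‖ :=
  abs_le_of_sq_le_sq (sq_prim_le g hx) (norm_nonneg _)

lemma abs_prim₂_le (g : L2) {x : ℝ} (hx : x ∈ Icc (0 : ℝ) 1) : |prim₂ g x| ≤ ‖g‖ :=
  abs_le_of_sq_le_sq (sq_prim₂_le g hx) (norm_nonneg _)

/-- The Taylor error is of order `|x - y|^{3/2}`, hence `o(|x - y|)`; so the derivative exists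
classically at every point although `g` is only in `L²`. -/
lemma hasDerivAt_prim₂ (g : L2) (y : ℝ) : HasDerivAt (prim₂ g) (prim g y) y := by
  rw [hasDerivAt_iff_isLittleO, Asymptotics.isLittleO_iff]
  intro c hc
  have hcont : Filter.Tendsto (fun x => |x - y| * ‖g‖ ^ 2) (nhds y) (nhds 0) := by
    have : Continuous fun x => |x - y| * ‖g‖ ^ 2 := by fun_prop
    simpa using this.tendsto y
  filter_upwards [hcont.eventually (gt_mem_nhds (show (0 : ℝ) < c ^ 2 by positivity))] with x hx
  have h := sq_prim₂_sub_le g (a := min x y) (b := max x y) (x := x) (y := y)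
    ⟨min_le_left _ _, le_max_left _ _⟩ ⟨min_le_right _ _, le_max_right _ _⟩
  have h1 := energy_le g (min_le_max (a := x) (b := y))
  rw [Real.norm_eq_abs, Real.norm_eq_abs, ← abs_of_pos hc, ← abs_mul]
  refine sq_le_sq.1 ?_
  rw [smul_eq_mul]
  calc _ = (prim₂ g x - (prim₂ g y + prim g y * (x - y))) ^ 2 := by ring
    _ ≤ |x - y| ^ 3 * energy g (min x y) (max x y) := h
    _ ≤ |x - y| ^ 3 * ‖g‖ ^ 2 := by gcongr
    _ = |x - y| ^ 2 * (|x - y| * ‖g‖ ^ 2) := by ring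
    _ ≤ |x - y| ^ 2 * c ^ 2 := by gcongr
    _ = _ := by rw [sq_abs]; ring

lemma continuous_prim₂ (g : L2) : Continuous (prim₂ g) :=
  continuous_iff_continuousAt.2 fun x => (hasDerivAt_prim₂ g x).continuousAt

lemma continuous_prim (g : L2) : Continuous (prim g) :=
  intervalIntegral.continuous_primitive (fun a b => intervalIntegrable_extZero g a b) 0

lemma _root_.Continuous.memLp_mu {f : ℝ → ℝ} (hf : Continuous f) : MemLp f 2 mu := by
  obtain ⟨C, hC⟩ := isCompact_Icc.exists_bound_of_continuousOn (s := Icc (0 : ℝ) 1)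
    hf.continuousOn
  refine MemLp.of_bound hf.aestronglyMeasurable C ?_
  exact (ae_restrict_iff' measurableSet_Ioo).2
    (Filter.Eventually.of_forall fun x hx => hC x (Ioo_subset_Icc_self hx))

/-- The constant is `C` itself because `(0,1)` has measure `1`. -/
lemma norm_le_of_forall_abs_le {u : L2} {f : ℝ → ℝ} {C : ℝ} (hC : 0 ≤ C) (hu : u =ᵐ[mu] f)
    (h : ∀ x ∈ Ioo (0 : ℝ) 1, |f x| ≤ C) : ‖u‖ ≤ C := by
  have h1 : ∀ᵐ x ∂mu, ‖u x‖ ≤ C := by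
    filter_upwards [hu, ae_restrict_mem measurableSet_Ioo] with x hx hx'
    rw [hx]
    exact h x hx'
  have := Lp.norm_le_of_ae_bound hC h1
  have hm : measureUnivNNReal mu = 1 := by simp [measureUnivNNReal]
  simpa [hm] using this

/-- The operator `g ↦ ∫₀ˣ g` on `L²(0,1)`. -/
def primL : L2 →L[ℝ] L2 :=
  LinearMap.mkContinuous
    { toFun := fun g => (continuous_prim g).memLp_mu.toLp _
      map_add' := fun g h => by
        rw [← MemLp.toLp_add]
        exact MemLp.toLp_congr _ _ (Filter.Eventually.of_forall fun x => prim_add g h x)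
      map_smul' := fun c g => by
        rw [RingHom.id_apply, ← MemLp.toLp_const_smul]
        exact MemLp.toLp_congr _ _ (Filter.Eventually.of_forall fun x => prim_smul c g x) }
    1 fun g => by
      rw [one_mul]
      exact norm_le_of_forall_abs_le (norm_nonneg _) (MemLp.coeFn_toLp (continuous_prim g).memLp_mu)
        fun x hx => abs_prim_le g (Ioo_subset_Icc_self hx)

/-- The operator `g ↦ ∫₀ˣ (x - t) g(t) dt` on `L²(0,1)`. -/
def primL₂ : L2 →L[ℝ] L2 :=
  LinearMap.mkContinuous
    { toFun := fun g => (continuous_prim₂ g).memLp_mu.toLp _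
      map_add' := fun g h => by
        rw [← MemLp.toLp_add]
        exact MemLp.toLp_congr _ _ (Filter.Eventually.of_forall fun x => prim₂_add g h x)
      map_smul' := fun c g => by
        rw [RingHom.id_apply, ← MemLp.toLp_const_smul]
        exact MemLp.toLp_congr _ _ (Filter.Eventually.of_forall fun x => prim₂_smul c g x) }
    1 fun g => by
      rw [one_mul]
      exact norm_le_of_forall_abs_le (norm_nonneg _) (MemLp.coeFn_toLp (continuous_prim₂ g).memLp_mu)
        fun x hx => abs_prim₂_le g (Ioo_subset_Icc_self hx)

lemma primL_ae_eq (g : L2) : primL g =ᵐ[mu] prim g :=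
  MemLp.coeFn_toLp (continuous_prim g).memLp_mu

lemma primL₂_ae_eq (g : L2) : primL₂ g =ᵐ[mu] prim₂ g :=
  MemLp.coeFn_toLp (continuous_prim₂ g).memLp_mu

lemma norm_primL_le (g : L2) : ‖primL g‖ ≤ ‖g‖ :=
  norm_le_of_forall_abs_le (norm_nonneg _) (primL_ae_eq g)
    fun _ hx => abs_prim_le g (Ioo_subset_Icc_self hx)

lemma norm_primL₂_le (g : L2) : ‖primL₂ g‖ ≤ ‖g‖ :=
  norm_le_of_forall_abs_le (norm_nonneg _) (primL₂_ae_eq g)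
    fun _ hx => abs_prim₂_le g (Ioo_subset_Icc_self hx)

/-! ### Test functions and weak derivatives -/

/-- The derivative of a test function. -/
def testDeriv (φ : 𝓓(Omega, ℝ)) : 𝓓(Omega, ℝ) :=
  ⟨deriv φ, (contDiff_infty_iff_deriv.1 φ.contDiff).2, φ.hasCompactSupport.deriv,
    tsupport_deriv_subset.trans φ.tsupport_subset⟩

@[simp] lemma coe_testDeriv (φ : 𝓓(Omega, ℝ)) : ⇑(testDeriv φ) = deriv φ := rfl

lemma test_continuous (φ : 𝓓(Omega, ℝ)) : Continuous φ := φ.contDiff.continuous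

lemma test_differentiable (φ : 𝓓(Omega, ℝ)) : Differentiable ℝ φ :=
  φ.contDiff.differentiable (by simp)

lemma test_hasDerivAt (φ : 𝓓(Omega, ℝ)) (x : ℝ) : HasDerivAt φ (testDeriv φ x) x :=
  (test_differentiable φ x).hasDerivAt

lemma test_eq_zero (φ : 𝓓(Omega, ℝ)) {x : ℝ} (hx : x ∉ Ioo (0 : ℝ) 1) : φ x = 0 :=
  image_eq_zero_of_notMem_tsupport fun h => hx (φ.tsupport_subset h)

lemma iteratedDeriv_one_test (φ : 𝓓(Omega, ℝ)) : iteratedDeriv 1 φ = testDeriv φ := by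
  rw [iteratedDeriv_one, coe_testDeriv]

lemma iteratedDeriv_two_test (φ : 𝓓(Omega, ℝ)) :
    iteratedDeriv 2 φ = testDeriv (testDeriv φ) := by
  rw [iteratedDeriv_succ, iteratedDeriv_one, coe_testDeriv, coe_testDeriv]

/-- The class in `L²(0,1)` of a test function. -/
def testClass (φ : 𝓓(Omega, ℝ)) : L2 := (test_continuous φ).memLp_mu.toLp φ

lemma testClass_ae_eq (φ : 𝓓(Omega, ℝ)) : testClass φ =ᵐ[mu] φ :=
  MemLp.coeFn_toLp (test_continuous φ).memLp_mu

lemma testClass_mem (φ : 𝓓(Omega, ℝ)) : testClass φ ∈ testClasses := ⟨φ, testClass_ae_eq φ⟩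

lemma integral_test (φ : 𝓓(Omega, ℝ)) : ∫ x, φ x ∂mu = ∫ x, φ x :=
  setIntegral_eq_integral_of_forall_compl_eq_zero fun _ hx => test_eq_zero φ hx

lemma integral_mul_testDeriv {f f' : ℝ → ℝ} (hf : ∀ x, HasDerivAt f (f' x) x)
    (hf' : Continuous f') (φ : 𝓓(Omega, ℝ)) :
    ∫ x, f x * testDeriv φ x ∂mu = -∫ x, f' x * φ x ∂mu := by
  have hfc : Continuous f := continuous_iff_continuousAt.2 fun x => (hf x).continuousAt
  rw [setIntegral_mul_of_tsupport _ _ fun _ => test_eq_zero _,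
    setIntegral_mul_of_tsupport _ _ fun _ => test_eq_zero _]
  exact integral_mul_deriv_eq_deriv_mul_of_integrable (fun x _ => hf x)
    (fun x _ => test_hasDerivAt φ x)
    ((hfc.mul (test_continuous _)).integrable_of_hasCompactSupport
      (testDeriv φ).hasCompactSupport.mul_left)
    ((hf'.mul (test_continuous _)).integrable_of_hasCompactSupport
      φ.hasCompactSupport.mul_left)
    ((hfc.mul (test_continuous _)).integrable_of_hasCompactSupport
      φ.hasCompactSupport.mul_left)

lemma hasWeakDeriv_one_iff {u g : L2} : HasWeakDeriv 1 u g ↔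
    ∀ φ : 𝓓(Omega, ℝ), ∫ x, u x * testDeriv φ x ∂mu = -∫ x, g x * φ x ∂mu := by
  simp only [HasWeakDeriv, iteratedDeriv_one_test, pow_one, neg_one_mul]

lemma hasWeakDeriv_two_iff {u g : L2} : HasWeakDeriv 2 u g ↔
    ∀ φ : 𝓓(Omega, ℝ),
      ∫ x, u x * testDeriv (testDeriv φ) x ∂mu = ∫ x, g x * φ x ∂mu := by
  simp only [HasWeakDeriv, iteratedDeriv_two_test, neg_one_sq, one_mul]

lemma integral_congr_mul {u : L2} {f : ℝ → ℝ} (h : u =ᵐ[mu] f) (ψ : ℝ → ℝ) :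
    ∫ x, u x * ψ x ∂mu = ∫ x, f x * ψ x ∂mu := by
  refine integral_congr_ae ?_
  filter_upwards [h] with x hx
  rw [hx]

lemma hasWeakDeriv_two_of_hasDerivAt {u g : L2} {f f' f'' : ℝ → ℝ} (hu : u =ᵐ[mu] f)
    (hg : g =ᵐ[mu] f'') (hf : ∀ x, HasDerivAt f (f' x) x) (hf' : ∀ x, HasDerivAt f' (f'' x) x)
    (hf'' : Continuous f'') : HasWeakDeriv 2 u g := by
  rw [hasWeakDeriv_two_iff]
  intro φ
  have hc : Continuous f' := continuous_iff_continuousAt.2 fun x => (hf' x).continuousAt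
  rw [integral_congr_mul hu, integral_congr_mul hg, integral_mul_testDeriv hf hc,
    integral_mul_testDeriv hf' hf'', neg_neg]

lemma hasWeakDeriv_one_test (φ : 𝓓(Omega, ℝ)) :
    HasWeakDeriv 1 (testClass φ) (testClass (testDeriv φ)) := by
  rw [hasWeakDeriv_one_iff]
  intro ψ
  rw [integral_congr_mul (testClass_ae_eq _), integral_congr_mul (testClass_ae_eq _),
    integral_mul_testDeriv (test_hasDerivAt φ) (test_continuous _)]

lemma hasWeakDeriv_two_test (φ : 𝓓(Omega, ℝ)) :
    HasWeakDeriv 2 (testClass φ) (testClass (testDeriv (testDeriv φ))) :=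
  hasWeakDeriv_two_of_hasDerivAt (testClass_ae_eq _) (testClass_ae_eq _) (test_hasDerivAt φ)
    (test_hasDerivAt _) (test_continuous _)

lemma hasWeakDeriv_zero (u : L2) : HasWeakDeriv 0 u u := by
  intro φ
  simp

lemma exists_test_integral_eq_one : ∃ φ : 𝓓(Omega, ℝ), ∫ x, φ x ∂mu = 1 := by
  obtain ⟨f, h1, h2, h3, h4, h5⟩ := exists_contDiff_tsupport_subset (n := ⊤)
    (isOpen_Ioo.mem_nhds (show (1 / 2 : ℝ) ∈ Ioo (0 : ℝ) 1 by constructor <;> norm_num))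
  let φ : 𝓓(Omega, ℝ) := ⟨f, h3, h2, h1⟩
  have hpos : 0 < ∫ x, φ x := by
    refine (test_continuous φ).integral_pos_of_hasCompactSupport_nonneg_nonzero
      φ.hasCompactSupport (fun x => (h4 (mem_range_self x)).1) (x := 1 / 2) ?_
    change f (1 / 2) ≠ 0
    rw [h5]
    norm_num
  refine ⟨(∫ x, φ x)⁻¹ • φ, ?_⟩
  rw [integral_test]
  change ∫ x, (∫ x, φ x)⁻¹ * φ x = 1
  rw [integral_const_mul, inv_mul_cancel₀ hpos.ne']

/-- The primitive from `0` vanishes to the left of the support of `ψ`, and to the right of it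
because the total integral is zero; so it is again a test function. -/
lemma exists_testDeriv_eq (ψ : 𝓓(Omega, ℝ)) (h : ∫ x, ψ x ∂mu = 0) :
    ∃ θ : 𝓓(Omega, ℝ), testDeriv θ = ψ := by
  have hd : ∀ x, HasDerivAt (fun x => ∫ t in (0 : ℝ)..x, ψ t) (ψ x) x := fun x =>
    intervalIntegral.integral_hasDerivAt_right ((test_continuous ψ).intervalIntegrable _ _)
      (test_continuous ψ).stronglyMeasurable.stronglyMeasurableAtFilter
      (test_continuous ψ).continuousAt
  have hd' : deriv (fun x => ∫ t in (0 : ℝ)..x, ψ t) = ψ := funext fun x => (hd x).deriv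
  obtain ⟨a, b, ha, hb, hab⟩ : ∃ a b : ℝ, 0 < a ∧ b < 1 ∧ tsupport ψ ⊆ Icc a b := by
    rcases (tsupport ψ).eq_empty_or_nonempty with he | hne
    · exact ⟨1, 0, one_pos, one_pos, by simp [he]⟩
    · obtain ⟨a, ha, ha'⟩ := ψ.hasCompactSupport.isCompact.exists_isLeast hne
      obtain ⟨b, hb, hb'⟩ := ψ.hasCompactSupport.isCompact.exists_isGreatest hne
      exact ⟨a, b, (ψ.tsupport_subset ha).1, (ψ.tsupport_subset hb).2,
        fun x hx => ⟨ha' hx, hb' hx⟩⟩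
  have hz : ∀ x, x ∉ Icc a b → ψ x = 0 := fun x hx =>
    image_eq_zero_of_notMem_tsupport fun hh => hx (hab hh)
  have h1 : ∫ t in (0 : ℝ)..1, ψ t = 0 := by
    rw [intervalIntegral.integral_of_le zero_le_one, integral_Ioc_eq_integral_Ioo, h]
  have hsupp : Function.support (fun x => ∫ t in (0 : ℝ)..x, ψ t) ⊆ Icc a b := by
    intro x hx
    by_contra hx'
    refine hx ?_
    rw [mem_Icc, not_and_or, not_le, not_le] at hx'
    rcases hx' with hx' | hx'
    · refine intervalIntegral.integral_zero_ae (Filter.Eventually.of_forall fun t ht => ?_)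
      refine hz t fun hh => ?_
      have := (mem_uIoc.1 ht)
      rcases this with h' | h' <;> linarith [hh.1, h'.1, h'.2]
    · have h2 := intervalIntegral.integral_add_adjacent_intervals
        ((test_continuous ψ).intervalIntegrable (μ := volume) 0 x)
        ((test_continuous ψ).intervalIntegrable (μ := volume) x 1)
      have h3 : ∫ t in x..1, ψ t = 0 := by
        refine intervalIntegral.integral_zero_ae (Filter.Eventually.of_forall fun t ht => ?_)
        refine hz t fun hh => ?_
        rcases (mem_uIoc.1 ht) with h' | h' <;> linarith [hh.2, h'.1, h'.2]
      change ∫ t in (0 : ℝ)..x, ψ t = 0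
      linarith
  have hts : tsupport (fun x => ∫ t in (0 : ℝ)..x, ψ t) ⊆ Icc a b :=
    closure_minimal hsupp isClosed_Icc
  refine ⟨⟨fun x => ∫ t in (0 : ℝ)..x, ψ t, ?_, ?_, ?_⟩, ?_⟩
  · refine contDiff_infty_iff_deriv.2 ⟨fun x => (hd x).differentiableAt, ?_⟩
    rw [hd']
    exact ψ.contDiff
  · exact isCompact_Icc.of_isClosed_subset (isClosed_tsupport _) hts
  · exact hts.trans fun x hx => ⟨ha.trans_le hx.1, hx.2.trans_lt hb⟩
  · exact DFunLike.ext' hd'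

/-- The fundamental lemma for first derivatives. -/
lemma ae_eq_const_of_integral_testDeriv {h : L2}
    (H : ∀ φ : 𝓓(Omega, ℝ), ∫ x, h x * testDeriv φ x ∂mu = 0) :
    ∃ c : ℝ, h =ᵐ[mu] fun _ => c := by
  obtain ⟨φ₁, h₁⟩ := exists_test_integral_eq_one
  set c := ∫ x, h x * φ₁ x ∂mu
  have hcm : MemLp (fun _ : ℝ => c) 2 mu := (continuous_const).memLp_mu
  refine ⟨c, ?_⟩
  -- A weak derivative of order `0` is equality tested against all test functions, so uniqueness of
  -- weak derivatives becomes the fundamental lemma. Subtracting `(∫ ψ) φ₁` from `ψ` makes it a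
  -- derivative of a test function.
  have key : HasWeakDeriv 0 h (hcm.toLp _) := by
    intro ψ
    have hi : ∀ φ : 𝓓(Omega, ℝ), Integrable φ mu := fun φ =>
      ((test_continuous φ).memLp_mu).integrable (by norm_num)
    obtain ⟨θ, hθ⟩ := exists_testDeriv_eq (ψ - (∫ x, ψ x ∂mu) • φ₁) (by
      change ∫ x, (ψ x - (∫ x, ψ x ∂mu) * φ₁ x) ∂mu = 0
      rw [integral_sub (hi ψ) ((hi φ₁).const_mul _), integral_const_mul, h₁]
      ring)
    have h2 := H θ
    rw [hθ] at h2
    have e : ∫ x, h x * (ψ - (∫ x, ψ x ∂mu) • φ₁) x ∂mu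
        = ∫ x, h x * ψ x ∂mu - (∫ x, ψ x ∂mu) * c := by
      rw [← integral_const_mul, ← integral_sub (integrable_mul_test h ψ)
        ((integrable_mul_test h φ₁).const_mul _)]
      refine integral_congr_ae (Filter.Eventually.of_forall fun x => ?_)
      change h x * (ψ x - (∫ x, ψ x ∂mu) * φ₁ x) = _
      ring
    rw [e] at h2
    rw [integral_congr_mul hcm.coeFn_toLp, integral_const_mul]
    simp only [iteratedDeriv_zero, pow_zero, one_mul]
    linarith
  rw [(hasWeakDeriv_zero h).unique key]
  exact hcm.coeFn_toLp

/-- The fundamental lemma for second derivatives. -/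
lemma ae_eq_affine_of_hasWeakDeriv_two_zero {h : L2}
    (H : ∀ φ : 𝓓(Omega, ℝ), ∫ x, h x * testDeriv (testDeriv φ) x ∂mu = 0) :
    ∃ c d : ℝ, h =ᵐ[mu] fun x => c + d * x := by
  obtain ⟨φ₁, h₁⟩ := exists_test_integral_eq_one
  set c := ∫ x, h x * testDeriv φ₁ x ∂mu
  have hi : ∀ φ : 𝓓(Omega, ℝ), Integrable φ mu := fun φ =>
      ((test_continuous φ).memLp_mu).integrable (by norm_num)
  -- The functional `ψ ↦ ∫ h ψ'` kills derivatives of test functions, so it depends on the mean of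
  -- `ψ` only.
  have h3 : ∀ ψ : 𝓓(Omega, ℝ), ∫ x, h x * testDeriv ψ x ∂mu = (∫ x, ψ x ∂mu) * c := by
    intro ψ
    obtain ⟨θ, hθ⟩ := exists_testDeriv_eq (ψ - (∫ x, ψ x ∂mu) • φ₁) (by
      change ∫ x, (ψ x - (∫ x, ψ x ∂mu) * φ₁ x) ∂mu = 0
      rw [integral_sub (hi ψ) ((hi φ₁).const_mul _), integral_const_mul, h₁]
      ring)
    have h2 := H θ
    rw [hθ] at h2
    have e : ∫ x, h x * testDeriv (ψ - (∫ x, ψ x ∂mu) • φ₁) x ∂mu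
        = ∫ x, h x * testDeriv ψ x ∂mu - (∫ x, ψ x ∂mu) * c := by
      rw [← integral_const_mul, ← integral_sub (integrable_mul_test h (testDeriv ψ))
        ((integrable_mul_test h (testDeriv φ₁)).const_mul _)]
      refine integral_congr_ae (Filter.Eventually.of_forall fun x => ?_)
      have : testDeriv (ψ - (∫ x, ψ x ∂mu) • φ₁) x
          = testDeriv ψ x - (∫ x, ψ x ∂mu) * testDeriv φ₁ x :=
        ((test_hasDerivAt ψ x).sub ((test_hasDerivAt φ₁ x).const_mul _)).deriv
      dsimp only
      rw [this]
      ring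
    linarith
  have hx : MemLp (fun x : ℝ => x) 2 mu := continuous_id.memLp_mu
  -- Since `∫ x ψ' = -∫ ψ`, adding `c x` to `h` cancels the remaining term `c ∫ ψ`.
  obtain ⟨d, hd⟩ := ae_eq_const_of_integral_testDeriv (h := h + c • hx.toLp _) (by
    intro ψ
    have e1 := integral_add_mul h (c • hx.toLp _) 0 (testDeriv ψ)
    have e2 := integral_smul_mul c (hx.toLp _) 0 (testDeriv ψ)
    simp only [iteratedDeriv_zero] at e1 e2
    rw [e1, e2, h3, integral_congr_mul hx.coeFn_toLp,
      integral_mul_testDeriv (f := fun x => x) (fun x => hasDerivAt_id x) continuous_const]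
    simp only [one_mul]
    ring)
  refine ⟨d, -c, ?_⟩
  filter_upwards [hd, Lp.coeFn_add h (c • hx.toLp _), Lp.coeFn_smul c (hx.toLp _),
    hx.coeFn_toLp] with x h1 h2 h4 h5
  rw [h2, Pi.add_apply, h4, Pi.smul_apply, h5, smul_eq_mul] at h1
  linarith

/-! ### Second primitives of second derivatives -/

lemma extZero_testClass (φ : 𝓓(Omega, ℝ)) : extZero (testClass φ) =ᵐ[volume] φ := by
  filter_upwards [extZero_congr (testClass_ae_eq φ)] with x hx
  rw [hx]
  by_cases h : x ∈ Ioo (0 : ℝ) 1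
  · rw [indicator_of_mem h]
  · rw [indicator_of_notMem h, test_eq_zero φ h]

lemma prim_testDeriv (φ : 𝓓(Omega, ℝ)) (x : ℝ) : prim (testClass (testDeriv φ)) x = φ x := by
  have h1 : prim (testClass (testDeriv φ)) x = ∫ t in (0 : ℝ)..x, testDeriv φ t := by
    refine intervalIntegral.integral_congr_ae ?_
    filter_upwards [extZero_testClass (testDeriv φ)] with t ht _ using ht
  rw [h1, intervalIntegral.integral_eq_sub_of_hasDerivAt (fun t _ => test_hasDerivAt φ t)
    ((test_continuous _).intervalIntegrable _ _), test_eq_zero φ (x := 0) (by simp), sub_zero]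

lemma prim₂_testDeriv (φ : 𝓓(Omega, ℝ)) (x : ℝ) :
    prim₂ (testClass (testDeriv (testDeriv φ))) x = φ x := by
  have h1 : ∫ t in (0 : ℝ)..x, t * extZero (testClass (testDeriv (testDeriv φ))) t
      = ∫ t in (0 : ℝ)..x, t * testDeriv (testDeriv φ) t := by
    refine intervalIntegral.integral_congr_ae ?_
    filter_upwards [extZero_testClass (testDeriv (testDeriv φ))] with t ht _
    rw [ht]
  have h2 : ∀ t, HasDerivAt (fun t => t * testDeriv φ t - φ t)
      (t * testDeriv (testDeriv φ) t) t := fun t => by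
    convert! ((hasDerivAt_id t).mul (test_hasDerivAt (testDeriv φ) t)).sub
      (test_hasDerivAt φ t) using 1
    simp
  rw [prim₂, prim_testDeriv, h1, intervalIntegral.integral_eq_sub_of_hasDerivAt
    (fun t _ => h2 t)
    ((continuous_id.mul (test_continuous (testDeriv (testDeriv φ)))).intervalIntegrable _ _),
    test_eq_zero φ (x := 0) (by simp)]
  ring

lemma primL_testDeriv (φ : 𝓓(Omega, ℝ)) :
    primL (testClass (testDeriv (testDeriv φ))) = testClass (testDeriv φ) := by
  refine Lp.ext ?_
  filter_upwards [primL_ae_eq (testClass (testDeriv (testDeriv φ))),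
    testClass_ae_eq (testDeriv φ)] with x h1 h2
  rw [h1, h2, prim_testDeriv]

lemma primL₂_testDeriv (φ : 𝓓(Omega, ℝ)) :
    primL₂ (testClass (testDeriv (testDeriv φ))) = testClass φ := by
  refine Lp.ext ?_
  filter_upwards [primL₂_ae_eq (testClass (testDeriv (testDeriv φ))),
    testClass_ae_eq φ] with x h1 h2
  rw [h1, h2, prim₂_testDeriv]

/-- The second derivatives of test functions. -/
def testSecondDerivs : Submodule ℝ L2 where
  carrier := {g | ∃ φ : 𝓓(Omega, ℝ), testClass (testDeriv (testDeriv φ)) = g}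
  zero_mem' := ⟨0, by
    refine Lp.ext ?_
    filter_upwards [testClass_ae_eq (testDeriv (testDeriv 0)), Lp.coeFn_zero ℝ 2 mu]
      with x h1 h2
    rw [h1, h2]
    have : deriv (⇑(0 : 𝓓(Omega, ℝ))) = 0 := by
      ext y
      exact deriv_const y 0
    rw [coe_testDeriv, coe_testDeriv, this]
    exact deriv_const x 0⟩
  add_mem' := by
    rintro _ _ ⟨φ, rfl⟩ ⟨ψ, rfl⟩
    have h : ∀ φ ψ : 𝓓(Omega, ℝ), testDeriv (φ + ψ) = testDeriv φ + testDeriv ψ :=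
      fun φ ψ => DFunLike.ext _ _ fun x =>
        ((test_hasDerivAt φ x).add (test_hasDerivAt ψ x)).deriv
    refine ⟨φ + ψ, ?_⟩
    rw [h, h]
    exact MemLp.toLp_add _ _
  smul_mem' := by
    rintro c _ ⟨φ, rfl⟩
    have h : ∀ φ : 𝓓(Omega, ℝ), testDeriv (c • φ) = c • testDeriv φ :=
      fun φ => DFunLike.ext _ _ fun x => ((test_hasDerivAt φ x).const_mul c).deriv
    refine ⟨c • φ, ?_⟩
    rw [h, h]
    exact MemLp.toLp_const_smul c _

/-- Identifies the two conditions `prim g 1 = 0` and `prim₂ g 1 = 0` with orthogonality to affine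
functions: `∫ t g(t) dt` over `(0,1)` is `prim g 1 - prim₂ g 1`. -/
lemma inner_affine {h : L2} {c d : ℝ} (hh : h =ᵐ[mu] fun x => c + d * x) (g : L2) :
    inner ℝ h g = c * prim g 1 + d * (prim g 1 - prim₂ g 1) := by
  have h1 : inner ℝ h g = ∫ t in (0 : ℝ)..1, (c * extZero g t + d * (t * extZero g t)) := by
    rw [L2.inner_def, intervalIntegral.integral_of_le zero_le_one, integral_Ioc_eq_integral_Ioo]
    refine integral_congr_ae ?_
    filter_upwards [extZero_ae_eq g, hh] with x h1 h2
    rw [h1, h2]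
    simp only [RCLike.inner_apply, conj_trivial]
    ring
  rw [h1, intervalIntegral.integral_add ((intervalIntegrable_extZero g _ _).const_mul _)
    ((intervalIntegrable_id_mul_extZero g _ _).const_mul _),
    intervalIntegral.integral_const_mul, intervalIntegral.integral_const_mul, prim₂, prim]
  ring

/-- By duality: whatever is orthogonal to all `φ''` is affine by the fundamental lemma, and `g` is
orthogonal to affine functions; so `g` lies in the double orthogonal complement. -/
lemma mem_closure_testSecondDerivs {g : L2} (h1 : prim g 1 = 0) (h2 : prim₂ g 1 = 0) :
    g ∈ testSecondDerivs.topologicalClosure := by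
  rw [← Submodule.orthogonal_orthogonal_eq_closure, Submodule.mem_orthogonal]
  intro h hh
  rw [Submodule.mem_orthogonal] at hh
  obtain ⟨c, d, hcd⟩ := ae_eq_affine_of_hasWeakDeriv_two_zero (h := h) (by
    intro φ
    rw [← hh _ ⟨φ, rfl⟩, L2.inner_def]
    refine integral_congr_ae ?_
    filter_upwards [testClass_ae_eq (testDeriv (testDeriv φ))] with x hx
    rw [hx]
    simp)
  rw [inner_affine hcd, h1, h2]
  ring

lemma continuous_integral_mul {f : ℝ → ℝ} (hf : MemLp f 2 mu) :
    Continuous fun u : L2 => ∫ x, u x * f x ∂mu := by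
  have : (fun u : L2 => ∫ x, u x * f x ∂mu) = fun u => inner ℝ (hf.toLp f) u := by
    ext u
    rw [L2.inner_def]
    refine integral_congr_ae ?_
    filter_upwards [hf.coeFn_toLp] with x hx
    rw [hx]
    simp
  rw [this]
  fun_prop

/-- For each fixed test function both sides are continuous in `g`. This carries weak derivatives
from test functions to their limits. -/
lemma isClosed_hasWeakDeriv (k : ℕ) {A B : L2 → L2} (hA : Continuous A) (hB : Continuous B) :
    IsClosed {g | HasWeakDeriv k (A g) (B g)} := by
  simp only [HasWeakDeriv, ofPred_forall]
  refine isClosed_iInter fun φ => isClosed_eq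
    ((continuous_integral_mul (memLp_iteratedDeriv k φ)).comp hA)
    (((continuous_integral_mul (test_continuous φ).memLp_mu).comp hB).const_mul _)

lemma hasWeakDeriv_primL₂ {g : L2} (h1 : prim g 1 = 0) (h2 : prim₂ g 1 = 0) :
    HasWeakDeriv 1 (primL₂ g) (primL g) ∧ HasWeakDeriv 2 (primL₂ g) g := by
  have hg := mem_closure_testSecondDerivs h1 h2
  constructor
  · refine closure_minimal ?_ (isClosed_hasWeakDeriv 1 primL₂.continuous primL.continuous) hg
    rintro _ ⟨φ, rfl⟩
    rw [mem_ofPred_eq, primL₂_testDeriv, primL_testDeriv]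
    exact hasWeakDeriv_one_test φ
  · refine closure_minimal ?_ (isClosed_hasWeakDeriv 2 primL₂.continuous continuous_id) hg
    rintro _ ⟨φ, rfl⟩
    rw [mem_ofPred_eq, primL₂_testDeriv]
    exact hasWeakDeriv_two_test φ

lemma primL₂_mem_sobolev {g : L2} (h1 : prim g 1 = 0) (h2 : prim₂ g 1 = 0) :
    primL₂ g ∈ sobolev 2 := by
  intro k hk
  interval_cases k
  · exact ⟨_, hasWeakDeriv_zero _⟩
  · exact ⟨_, (hasWeakDeriv_primL₂ h1 h2).1⟩
  · exact ⟨_, (hasWeakDeriv_primL₂ h1 h2).2⟩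

lemma sobolevNorm_two_sq (u : L2) : sobolevNorm 2 u ^ 2
    = ‖weakDeriv 0 u‖ ^ 2 + ‖weakDeriv 1 u‖ ^ 2 + ‖weakDeriv 2 u‖ ^ 2 := by
  rw [sobolevNorm, Real.sq_sqrt (Finset.sum_nonneg fun _ _ => sq_nonneg _),
    Fin.sum_univ_three]
  rfl

/-- Approximating `g` by `φ''` in `L²` is enough: the difference `d` again has vanishing moments, so
all three terms of the squared Sobolev norm are at most `‖d‖ ^ 2`, and `3 (ε / 2) ^ 2 < ε ^ 2`. -/
lemma primL₂_mem_sobolevZero {g : L2} (h1 : prim g 1 = 0) (h2 : prim₂ g 1 = 0) :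
    primL₂ g ∈ sobolevZero 2 := by
  refine ⟨primL₂_mem_sobolev h1 h2, fun ε hε => ?_⟩
  have hg := mem_closure_testSecondDerivs h1 h2
  obtain ⟨_, ⟨φ, rfl⟩, hφ⟩ := Metric.mem_closure_iff.1 hg (ε / 2) (half_pos hε)
  refine ⟨testClass φ, testClass_mem φ, ?_⟩
  set d := g - testClass (testDeriv (testDeriv φ))
  rw [dist_eq_norm] at hφ
  have hd : g = testClass (testDeriv (testDeriv φ)) + d := by simp [d]
  have d1 : prim d 1 = 0 := by
    have := prim_add (testClass (testDeriv (testDeriv φ))) d 1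
    rw [← hd, h1, prim_testDeriv, test_eq_zero _ (by simp)] at this
    linarith
  have d2 : prim₂ d 1 = 0 := by
    have := prim₂_add (testClass (testDeriv (testDeriv φ))) d 1
    rw [← hd, h2, prim₂_testDeriv, test_eq_zero _ (by simp)] at this
    linarith
  have e : primL₂ g - testClass φ = primL₂ d := by
    rw [← primL₂_testDeriv φ, ← map_sub]
  have hw := hasWeakDeriv_primL₂ d1 d2
  have hn : sobolevNorm 2 (primL₂ d) ^ 2 ≤ 3 * ‖d‖ ^ 2 := by
    rw [sobolevNorm_two_sq, (hasWeakDeriv_zero _).weakDeriv_eq, hw.1.weakDeriv_eq,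
      hw.2.weakDeriv_eq]
    have a1 := pow_le_pow_left₀ (norm_nonneg _) (norm_primL_le d) 2
    have a2 := pow_le_pow_left₀ (norm_nonneg _) (norm_primL₂_le d) 2
    linarith
  rw [e]
  refine lt_of_pow_lt_pow_left₀ 2 hε.le ?_
  have := norm_nonneg d
  change ‖d‖ < ε / 2 at hφ
  nlinarith

lemma eq_zero_of_forall_norm_le {x C : ℝ} (hC : 0 ≤ C) (h : ∀ ε > 0, |x| ≤ C * ε) : x = 0 := by
  by_contra hx
  have hx' := abs_pos.2 hx
  have := h (|x| / (2 * (C + 1))) (by positivity)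
  rw [mul_div_assoc', le_div_iff₀ (by positivity)] at this
  nlinarith

/-- A function in `H₀²(0,1)` is the second primitive of its second derivative, the moments of
which of order at most `1` vanish. -/
lemma eq_primL₂_of_mem_sobolevZero {v : L2} (hv : v ∈ sobolevZero 2) :
    v = primL₂ (weakDeriv 2 v) ∧ prim (weakDeriv 2 v) 1 = 0 ∧ prim₂ (weakDeriv 2 v) 1 = 0 := by
  set g := weakDeriv 2 v with hgdef
  -- The three identities hold for test functions and are stable under `L²`-convergence of `v` and
  -- `v''` together, so approximation by one sequence `φ` proves all of them.
  have key : ∀ ε > 0, ∃ φ : 𝓓(Omega, ℝ), ‖v - testClass φ‖ ≤ ε ∧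
      ‖g - testClass (testDeriv (testDeriv φ))‖ ≤ ε := by
    intro ε hε
    obtain ⟨w, ⟨φ, hφ⟩, hw⟩ := hv.2 ε hε
    obtain rfl : w = testClass φ := Lp.ext (hφ.trans (testClass_ae_eq φ).symm)
    obtain ⟨g', hg'⟩ := hv.1 2 le_rfl
    have e2 : weakDeriv 2 (v - testClass φ) = g - testClass (testDeriv (testDeriv φ)) := by
      have h := (hg'.add ((hasWeakDeriv_two_test φ).smul (-1))).weakDeriv_eq
      rw [hgdef, hg'.weakDeriv_eq]
      simpa [sub_eq_add_neg] using h
    have hs := sobolevNorm_two_sq (v - testClass φ)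
    rw [(hasWeakDeriv_zero _).weakDeriv_eq, e2] at hs
    have h0 : 0 ≤ sobolevNorm 2 (v - testClass φ) := Real.sqrt_nonneg _
    have hsq : sobolevNorm 2 (v - testClass φ) ^ 2 ≤ ε ^ 2 := by gcongr
    exact ⟨φ, abs_le_of_sq_le_sq (by nlinarith) hε.le |>.trans' (le_abs_self _),
      abs_le_of_sq_le_sq (by nlinarith) hε.le |>.trans' (le_abs_self _)⟩
  have split : ∀ φ : 𝓓(Omega, ℝ), g = testClass (testDeriv (testDeriv φ))
      + (g - testClass (testDeriv (testDeriv φ))) := fun φ => by simp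
  refine ⟨?_, ?_, ?_⟩
  · rw [← sub_eq_zero, ← norm_eq_zero]
    refine eq_zero_of_forall_norm_le (C := 2) (by norm_num) fun ε hε => ?_
    obtain ⟨φ, h1, h2⟩ := key ε hε
    have e : v - primL₂ g = (v - testClass φ)
        - primL₂ (g - testClass (testDeriv (testDeriv φ))) := by
      rw [map_sub, primL₂_testDeriv]
      abel
    rw [abs_norm, e]
    refine (norm_sub_le _ _).trans ?_
    linarith [norm_primL₂_le (g - testClass (testDeriv (testDeriv φ)))]
  · refine eq_zero_of_forall_norm_le (C := 1) (by norm_num) fun ε hε => ?_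
    obtain ⟨φ, h1, h2⟩ := key ε hε
    rw [split φ, prim_add, prim_testDeriv, test_eq_zero _ (by simp), zero_add, one_mul]
    exact (abs_prim_le _ (by simp)).trans h2
  · refine eq_zero_of_forall_norm_le (C := 1) (by norm_num) fun ε hε => ?_
    obtain ⟨φ, h1, h2⟩ := key ε hε
    rw [split φ, prim₂_add, prim₂_testDeriv, test_eq_zero _ (by simp), zero_add, one_mul]
    exact (abs_prim₂_le _ (by simp)).trans h2

/-- Functions in `H²(0,1)` have differentiable representatives. -/
lemma exists_differentiable_of_mem_sobolev {u : L2} (hu : u ∈ sobolev 2) :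
    ∃ F : ℝ → ℝ, Differentiable ℝ F ∧ u =ᵐ[mu] F := by
  obtain ⟨g, hg⟩ := hu 2 le_rfl
  obtain ⟨A, B, hA, hB⟩ : ∃ A B : ℝ, 2 * A + 3 * B = prim g 1 ∧ A + B = prim₂ g 1 :=
    ⟨3 * prim₂ g 1 - prim g 1, prim g 1 - 2 * prim₂ g 1, by ring, by ring⟩
  have hp : Continuous fun x : ℝ => 2 * A + 6 * B * x := by fun_prop
  have hq : Continuous fun x : ℝ => A * x ^ 2 + B * x ^ 3 := by fun_prop
  have hxp : Continuous fun x : ℝ => x * (2 * A + 6 * B * x) := by fun_prop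
  set p : L2 := hp.memLp_mu.toLp _
  set q : L2 := hq.memLp_mu.toLp _
  have hpe : p =ᵐ[mu] fun x : ℝ => 2 * A + 6 * B * x := hp.memLp_mu.coeFn_toLp
  have hqe : q =ᵐ[mu] fun x : ℝ => A * x ^ 2 + B * x ^ 3 := hq.memLp_mu.coeFn_toLp
  have hqp : HasWeakDeriv 2 q p := by
    refine hasWeakDeriv_two_of_hasDerivAt (f' := fun x => 2 * A * x + 3 * B * x ^ 2)
      hqe hpe (fun x => ?_) (fun x => ?_) hp
    · convert! ((hasDerivAt_pow 2 x).const_mul A).add ((hasDerivAt_pow 3 x).const_mul B) using 1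
      push_cast
      ring
    · convert! ((hasDerivAt_id x).const_mul (2 * A)).add
        ((hasDerivAt_pow 2 x).const_mul (3 * B)) using 1
      push_cast
      ring
  have hcong : ∀ w : ℝ → ℝ, ∫ t in (0 : ℝ)..1, w t * extZero p t
      = ∫ t in (0 : ℝ)..1, w t * (2 * A + 6 * B * t) := by
    intro w
    rw [intervalIntegral.integral_of_le zero_le_one, intervalIntegral.integral_of_le zero_le_one,
      integral_Ioc_eq_integral_Ioo, integral_Ioc_eq_integral_Ioo]
    refine integral_congr_ae ?_
    filter_upwards [extZero_ae_eq p, hpe] with x h1 h2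
    rw [h1, h2]
  have hp1 : prim p 1 = 2 * A + 3 * B := by
    have h := hcong fun _ => 1
    simp only [one_mul] at h
    rw [prim, h, intervalIntegral.integral_eq_sub_of_hasDerivAt
      (f := fun x => 2 * A * x + 3 * B * x ^ 2) (fun x _ => ?_) (hp.intervalIntegrable _ _)]
    · ring
    · convert! ((hasDerivAt_id x).const_mul (2 * A)).add
        ((hasDerivAt_pow 2 x).const_mul (3 * B)) using 1
      push_cast
      ring
  have hp2 : prim₂ p 1 = A + B := by
    rw [prim₂, hp1, hcong fun t => t, intervalIntegral.integral_eq_sub_of_hasDerivAt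
      (f := fun x => A * x ^ 2 + 2 * B * x ^ 3) (fun x _ => ?_)
      (hxp.intervalIntegrable _ _)]
    · ring
    · convert! ((hasDerivAt_pow 2 x).const_mul A).add
        ((hasDerivAt_pow 3 x).const_mul (2 * B)) using 1
      push_cast
      ring
  set r : L2 := g + (-1 : ℝ) • p
  have hr1 : prim r 1 = 0 := by rw [prim_add, prim_smul, hp1, hA]; ring
  have hr2 : prim₂ r 1 = 0 := by rw [prim₂_add, prim₂_smul, hp2, hB]; ring
  have hw := (hg.add (hqp.smul (-1))).add ((hasWeakDeriv_primL₂ hr1 hr2).2.smul (-1))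
  have hz : g + (-1 : ℝ) • p + (-1 : ℝ) • r = 0 := by
    simp only [r]
    module
  rw [hz, hasWeakDeriv_two_iff] at hw
  obtain ⟨c, d, hcd⟩ := ae_eq_affine_of_hasWeakDeriv_two_zero fun φ => by
    rw [hw φ, integral_congr_mul (Lp.coeFn_zero ℝ 2 mu)]
    simp
  refine ⟨fun x => c + d * x + (A * x ^ 2 + B * x ^ 3) + prim₂ r x, ?_, ?_⟩
  · have : Differentiable ℝ (prim₂ r) := fun x => (hasDerivAt_prim₂ r x).differentiableAt
    fun_prop
  · filter_upwards [hcd, Lp.coeFn_add (u + (-1 : ℝ) • q) ((-1 : ℝ) • primL₂ r),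
      Lp.coeFn_add u ((-1 : ℝ) • q), Lp.coeFn_smul (-1 : ℝ) q, Lp.coeFn_smul (-1 : ℝ) (primL₂ r),
      primL₂_ae_eq r, hqe] with x h1 h2 h3 h4 h5 h6 h7
    rw [h2, Pi.add_apply, h3, Pi.add_apply, h4, h5, Pi.smul_apply, Pi.smul_apply, h6, h7,
      smul_eq_mul, smul_eq_mul] at h1
    linarith

/-! ### Quadratic B-splines -/

lemma IsOpenKnotVector.le {p N : ℕ} {ξ : ℕ → ℝ} (h : IsOpenKnotVector p N ξ) {i j : ℕ}
    (hij : i ≤ j) (hj : j ≤ N + p) : ξ i ≤ ξ j := by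
  induction j, hij using Nat.le_induction with
  | base => exact le_rfl
  | succ j hij ih => exact (ih (by omega)).trans (h.mono j (by omega))

lemma IsOpenKnotVector.mem_Icc {p N : ℕ} {ξ : ℕ → ℝ} (h : IsOpenKnotVector p N ξ) {i : ℕ}
    (hi : i ≤ N + p) : ξ i ∈ Icc (0 : ℝ) 1 := by
  rw [← h.left 0 (Nat.zero_le p), ← h.right (N + p) (Nat.le_add_right N p) le_rfl]
  exact ⟨h.le (Nat.zero_le i) hi, h.le hi le_rfl⟩

lemma measurable_bspline (ξ : ℕ → ℝ) (q i : ℕ) : Measurable (bspline ξ q i) := by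
  induction q generalizing i with
  | zero =>
    have : bspline ξ 0 i = indicator (Ico (ξ i) (ξ (i + 1))) fun _ => 1 := by
      ext x
      simp [bspline, indicator_apply]
    rw [this]
    exact measurable_const.indicator measurableSet_Ico
  | succ q ih =>
    have h1 := ih i
    have h2 := ih (i + 1)
    have : bspline ξ (q + 1) i = fun x => (x - ξ i) / (ξ (i + q + 1) - ξ i) * bspline ξ q i x
        + (ξ (i + q + 2) - x) / (ξ (i + q + 2) - ξ (i + 1)) * bspline ξ q (i + 1) x := by
      ext x
      rw [bspline]
    rw [this]
    fun_prop

lemma exists_abs_bspline_le (ξ : ℕ → ℝ) (q i : ℕ) :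
    ∃ C, ∀ x ∈ Ioo (0 : ℝ) 1, |bspline ξ q i x| ≤ C := by
  induction q generalizing i with
  | zero =>
    refine ⟨1, fun x _ => ?_⟩
    rw [bspline]
    split_ifs <;> simp
  | succ q ih =>
    obtain ⟨C, hC⟩ := ih i
    obtain ⟨D, hD⟩ := ih (i + 1)
    refine ⟨(1 + |ξ i|) / |ξ (i + q + 1) - ξ i| * C
      + (|ξ (i + q + 2)| + 1) / |ξ (i + q + 2) - ξ (i + 1)| * D, fun x hx => ?_⟩
    have hx1 : |x| ≤ 1 := abs_le.2 ⟨by linarith [hx.1], hx.2.le⟩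
    rw [bspline]
    refine (abs_add_le _ _).trans ?_
    rw [abs_mul, abs_mul, abs_div, abs_div]
    gcongr
    · exact (abs_sub _ _).trans (by gcongr)
    · exact hC x hx
    · exact (abs_sub _ _).trans (by gcongr)
    · exact hD x hx

lemma memLp_bspline (ξ : ℕ → ℝ) (q i : ℕ) : MemLp (bspline ξ q i) 2 mu := by
  obtain ⟨C, hC⟩ := exists_abs_bspline_le ξ q i
  refine MemLp.of_bound (measurable_bspline ξ q i).aestronglyMeasurable C ?_
  exact (ae_restrict_iff' measurableSet_Ioo).2 (Filter.Eventually.of_forall hC)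

/-- The quadratic polynomial with the B-spline coefficients `c₀, c₁, c₂` on the knot interval
`[a,b]` with neighbouring knots `l` and `r`. -/
def quadSpline (l a b r c₀ c₁ c₂ x : ℝ) : ℝ :=
  c₀ * ((b - x) / (b - l) * ((b - x) / (b - a)))
    + c₁ * ((x - l) / (b - l) * ((b - x) / (b - a)) + (r - x) / (r - a) * ((x - a) / (b - a)))
    + c₂ * ((x - a) / (r - a) * ((x - a) / (b - a)))

lemma bspline_two (ξ : ℕ → ℝ) (i : ℕ) (x : ℝ) : bspline ξ 2 i x
    = (x - ξ i) / (ξ (i + 2) - ξ i) * ((x - ξ i) / (ξ (i + 1) - ξ i) * bspline ξ 0 i x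
        + (ξ (i + 2) - x) / (ξ (i + 2) - ξ (i + 1)) * bspline ξ 0 (i + 1) x)
      + (ξ (i + 3) - x) / (ξ (i + 3) - ξ (i + 1))
        * ((x - ξ (i + 1)) / (ξ (i + 2) - ξ (i + 1)) * bspline ξ 0 (i + 1) x
          + (ξ (i + 3) - x) / (ξ (i + 3) - ξ (i + 2)) * bspline ξ 0 (i + 2) x) := by
  simp only [bspline, add_assoc, Nat.reduceAdd]

lemma bspline_zero_eq {N : ℕ} {ξ : ℕ → ℝ} (h : IsOpenKnotVector 2 N ξ) {i k : ℕ}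
    (hi : i + 1 ≤ N + 2) (hk : k + 1 ≤ N + 2) {x : ℝ} (hx : x ∈ Ico (ξ k) (ξ (k + 1))) :
    bspline ξ 0 i x = if i = k then 1 else 0 := by
  rw [bspline]
  rcases lt_trichotomy i k with hik | rfl | hik
  · have : ξ (i + 1) ≤ ξ k := h.le hik (by omega)
    rw [if_neg (fun hh => by linarith [hx.1, hh.2]), if_neg hik.ne]
  · rw [if_pos (mem_Ico.1 hx), if_pos rfl]
  · have : ξ (k + 1) ≤ ξ i := h.le hik (by omega)
    rw [if_neg (fun hh => by linarith [hx.2, hh.1]), if_neg hik.ne']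

/-- On one knot span only the three B-splines whose support contains it survive. -/
lemma sum_bspline_eq {n : ℕ} {ξ : ℕ → ℝ} (h : IsOpenKnotVector 2 (n + 2) ξ) (c : ℕ → ℝ)
    {j : ℕ} (hj : j < n) {x : ℝ} (hx : x ∈ Ico (ξ (j + 2)) (ξ (j + 3))) :
    ∑ i ∈ Finset.range (n + 2), c i * bspline ξ 2 i x
      = quadSpline (ξ (j + 1)) (ξ (j + 2)) (ξ (j + 3)) (ξ (j + 4)) (c j) (c (j + 1))
          (c (j + 2)) x := by
  set l := ξ (j + 1)
  set a := ξ (j + 2)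
  set b := ξ (j + 3)
  set r := ξ (j + 4)
  have key : ∀ i ∈ Finset.range (n + 2), c i * bspline ξ 2 i x
      = (if i = j then c j * ((b - x) / (b - l) * ((b - x) / (b - a))) else 0)
        + (if i = j + 1 then c (j + 1) * ((x - l) / (b - l) * ((b - x) / (b - a))
            + (r - x) / (r - a) * ((x - a) / (b - a))) else 0)
        + (if i = j + 2 then c (j + 2) * ((x - a) / (r - a) * ((x - a) / (b - a))) else 0) := by
    intro i hi
    rw [Finset.mem_range] at hi
    have e0 := bspline_zero_eq h (i := i) (k := j + 2) (by omega) (by omega) hx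
    have e1 := bspline_zero_eq h (i := i + 1) (k := j + 2) (by omega) (by omega) hx
    have e2 := bspline_zero_eq h (i := i + 2) (k := j + 2) (by omega) (by omega) hx
    rw [bspline_two, e0, e1, e2]
    by_cases h0 : i = j
    · subst h0
      simp [l, a, b]
    by_cases h1 : i = j + 1
    · subst h1
      simp [l, a, b, r]
    by_cases h2 : i = j + 2
    · subst h2
      simp [a, b, r]
    · simp [h0, h1, h2]
  rw [Finset.sum_congr rfl key, Finset.sum_add_distrib, Finset.sum_add_distrib,
    Finset.sum_ite_eq', Finset.sum_ite_eq', Finset.sum_ite_eq', if_pos (by simp; omega),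
    if_pos (by simp; omega), if_pos (by simp; omega), quadSpline]

lemma exists_mem_knot_Ico {n : ℕ} {ξ : ℕ → ℝ} (h : IsOpenKnotVector 2 (n + 2) ξ) {x : ℝ}
    (hx : x ∈ Ico (0 : ℝ) 1) : ∃ j < n, x ∈ Ico (ξ (j + 2)) (ξ (j + 3)) := by
  have key : ∀ m, x < ξ (m + 2) → ∃ j < m, x ∈ Ico (ξ (j + 2)) (ξ (j + 3)) := by
    intro m
    induction m with
    | zero =>
      intro hm
      rw [h.left 2 le_rfl] at hm
      linarith [hx.1]
    | succ m ih =>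
      intro hm
      by_cases hc : x < ξ (m + 2)
      · obtain ⟨j, hj, hj'⟩ := ih hc
        exact ⟨j, by omega, hj'⟩
      · exact ⟨m, by omega, not_lt.1 hc, hm⟩
  refine key n ?_
  rw [h.right (n + 2) le_rfl (by omega)]
  exact hx.2

/-- At an endpoint, values agree by continuity and derivatives by uniqueness of the one-sided
derivative. -/
lemma HasDerivAt.eq_of_eqOn_Ioo {F p : ℝ → ℝ} {F' p' a b z : ℝ} (hab : a < b)
    (hz : z ∈ Icc a b) (hF : HasDerivAt F F' z) (hp : HasDerivAt p p' z)
    (h : EqOn F p (Ioo a b)) : F z = p z ∧ F' = p' := by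
  have hzc : z ∈ closure (Ioo a b) := by rwa [closure_Ioo hab.ne]
  have hne : (nhdsWithin z (Ioo a b)).NeBot := mem_closure_iff_nhdsWithin_neBot.1 hzc
  have hv : F z = p z :=
    tendsto_nhds_unique_of_eventuallyEq (hF.continuousAt.continuousWithinAt (s := Ioo a b))
      hp.continuousAt.continuousWithinAt
      (Filter.eventuallyEq_of_mem self_mem_nhdsWithin h)
  refine ⟨hv, ?_⟩
  have hu : UniqueDiffWithinAt ℝ (Ioo a b) z :=
    uniqueDiffWithinAt_convex (convex_Ioo a b) (by rwa [interior_Ioo, nonempty_Ioo]) hzc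
  exact hu.eq_deriv _ (hF.hasDerivWithinAt)
    (hp.hasDerivWithinAt.congr h hv)

lemma ae_restrict_mono_mu {u v : ℝ → ℝ} (h : u =ᵐ[mu] v) {a b : ℝ} (ha : 0 ≤ a) (hb : b ≤ 1) :
    u =ᵐ[volume.restrict (Ioo a b)] v :=
  ae_restrict_of_ae_restrict_of_subset (Ioo_subset_Ioo ha hb) h

lemma bspline_mem_splineSpace {N : ℕ} (ξ : ℕ → ℝ) (p : ℕ) {i : ℕ} (hi : i < N) :
    (memLp_bspline ξ p i).toLp _ ∈ splineSpace p N ξ :=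
  ⟨bspline ξ p i, Submodule.subset_span ⟨⟨i, hi⟩, rfl⟩, MemLp.coeFn_toLp _⟩

/-- A spline space contained in `H²(0,1)` has simple interior knots. -/
lemma knot_lt_succ {n : ℕ} {ξ : ℕ → ℝ} (h : IsOpenKnotVector 2 (n + 2) ξ)
    (hS : splineSpace 2 (n + 2) ξ ≤ sobolev 2) {j : ℕ} (hj : j < n) :
    ξ (j + 2) < ξ (j + 3) := by
  induction j with
  | zero => exact h.left_lt
  | succ j ih =>
    have ha := ih (by omega)
    refine lt_of_le_of_ne (h.mono _ (by omega)) fun hz => ?_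
    change ξ (j + 3) = ξ (j + 4) at hz
    -- This B-spline has knots `a < z = z ≤ ξ (j + 5)`. To the left of `z` it rises to `1` with
    -- slope `2 / (z - a)`, to the right it stays at most `1`; no differentiable function does this.
    -- The induction hypothesis supplies `a < z`.
    have hmem := bspline_mem_splineSpace ξ 2 (N := n + 2) (i := j + 2) (by omega)
    obtain ⟨F, hF, hFe⟩ := exists_differentiable_of_mem_sobolev (hS hmem)
    have hFB : F =ᵐ[mu] bspline ξ 2 (j + 2) :=
      hFe.symm.trans (MemLp.coeFn_toLp (memLp_bspline ξ 2 (j + 2)))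
    set a := ξ (j + 2) with hadef
    set z := ξ (j + 3) with hzdef
    have ha0 : 0 ≤ a := (h.mem_Icc (by omega)).1
    have hz1 : z < 1 := by
      have h1 : z ≤ ξ (n + 1) := h.le (by omega) (by omega)
      have h2 := h.lt_right
      rw [h.right (n + 2) le_rfl (by omega)] at h2
      exact h1.trans_lt h2
    have hza : 0 < z - a := sub_pos.2 ha
    have hleft : ∀ x ∈ Ioo a z, bspline ξ 2 (j + 2) x = ((x - a) / (z - a)) ^ 2 := by
      intro x hx
      have e0 : a ≤ x := hx.1.le
      have e1 : x < z := hx.2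
      have e2 : ¬ z ≤ x := not_le.2 hx.2
      simp only [bspline, ← hadef, ← hzdef, add_assoc, Nat.reduceAdd, ← hz, e0, e1, e2]
      simp
      ring
    have hright : ∀ x ∈ Ioo z 1, bspline ξ 2 (j + 2) x ≤ 1 := by
      intro x hx
      have e1 : ¬ x < z := not_lt.2 hx.1.le
      have e2 : z ≤ x := hx.1.le
      simp only [bspline, ← hadef, ← hzdef, add_assoc, Nat.reduceAdd, ← hz, e1, e2]
      by_cases e3 : x < ξ (j + 5)
      · simp only [e3]
        have hd : (ξ (j + 5) - x) / (ξ (j + 5) - z) ≤ 1 := by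
          rw [div_le_one (by linarith)]
          linarith
        have hd0 : 0 ≤ (ξ (j + 5) - x) / (ξ (j + 5) - z) :=
          div_nonneg (by linarith) (by linarith)
        simp
        nlinarith
      · simp [e3]
    have hd1 : HasDerivAt (fun x => ((x - a) / (z - a)) ^ 2) (2 / (z - a)) z := by
      have := (((hasDerivAt_id z).sub_const a).div_const (z - a)).pow 2
      convert! this using 1
      simp only [id_eq]
      rw [div_self hza.ne']
      push_cast
      ring
    obtain ⟨v1, v2⟩ := HasDerivAt.eq_of_eqOn_Ioo ha ⟨ha.le, le_rfl⟩ (hF z).hasDerivAt hd1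
      (Measure.eqOn_Ioo_of_ae_eq (μ := volume) (by
        filter_upwards [ae_restrict_mono_mu hFB ha0 hz1.le, ae_restrict_mem measurableSet_Ioo]
          with x hx hx'
        rw [hx, hleft x hx']) hF.continuous.continuousOn (by fun_prop))
    rw [div_self hza.ne', one_pow] at v1
    -- Comparing the continuous functions `F` and `min F 1` turns the almost everywhere bound into a
    -- pointwise one.
    have hle : ∀ x ∈ Ioo z 1, F x ≤ 1 := by
      have : EqOn F (fun x => min (F x) 1) (Ioo z 1) :=
        Measure.eqOn_Ioo_of_ae_eq (μ := volume) (by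
          filter_upwards [ae_restrict_mono_mu hFB (ha0.trans ha.le) le_rfl,
            ae_restrict_mem measurableSet_Ioo] with x hx hx'
          rw [hx, min_eq_left (hright x hx')]) hF.continuous.continuousOn
          (hF.continuous.min continuous_const).continuousOn
      intro x hx
      have hx' := this hx
      dsimp only at hx'
      rw [hx']
      exact min_le_right _ _
    have hs := hasDerivAt_iff_tendsto_slope.1 (hF z).hasDerivAt
    rw [v2] at hs
    have hpos := (hs.eventually (lt_mem_nhds (show 0 < 2 / (z - a) by positivity))).filter_mono
      (nhdsWithin_mono z (show Ioi z ⊆ {z}ᶜ from fun y hy => ne_of_gt hy))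
    obtain ⟨y, hy1, hy2⟩ := (hpos.and (Ioo_mem_nhdsGT hz1)).exists
    rw [slope_def_field, v1] at hy1
    have hy3 : 0 < y - z := sub_pos.2 hy2.1
    have := (div_pos_iff_of_pos_right hy3).1 hy1
    linarith [hle y hy2]

/-! ### Quadratic splines as second primitives of step functions -/

/-- The value at the knot `ξ (j + 2)` of the spline with coefficients `c`. -/
def knotValue (ξ c : ℕ → ℝ) (j : ℕ) : ℝ :=
  (c j * (ξ (j + 3) - ξ (j + 2)) + c (j + 1) * (ξ (j + 2) - ξ (j + 1)))
    / (ξ (j + 3) - ξ (j + 1))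

/-- The slope at the knot `ξ (j + 2)` of the spline with coefficients `c`. -/
def knotSlope (ξ c : ℕ → ℝ) (j : ℕ) : ℝ :=
  2 * (c (j + 1) - c j) / (ξ (j + 3) - ξ (j + 1))

/-- The second derivative on `(ξ (j + 2), ξ (j + 3))` of the spline with coefficients `c`. -/
def spanCurvature (ξ c : ℕ → ℝ) (j : ℕ) : ℝ :=
  (knotSlope ξ c (j + 1) - knotSlope ξ c j) / (ξ (j + 3) - ξ (j + 2))

/-- Taylor expansion at the left knot `a`; its coefficients are the expressions in `knotValue`,
`knotSlope` and `spanCurvature`. -/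
lemma quadSpline_eq {l a b r : ℝ} (hl : l ≤ a) (hab : a < b) (hr : b ≤ r) (c₀ c₁ c₂ x : ℝ) :
    quadSpline l a b r c₀ c₁ c₂ x
      = (c₀ * (b - a) + c₁ * (a - l)) / (b - l) + 2 * (c₁ - c₀) / (b - l) * (x - a)
        + (2 * (c₂ - c₁) / (r - a) - 2 * (c₁ - c₀) / (b - l)) / (b - a) / 2 * (x - a) ^ 2 := by
  have h1 : b - a ≠ 0 := by linarith [hab] |> fun h : 0 < b - a => h.ne'
  have h2 : b - l ≠ 0 := (show 0 < b - l by linarith).ne'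
  have h3 : r - a ≠ 0 := (show 0 < r - a by linarith).ne'
  rw [quadSpline]
  field_simp
  ring

/-- Adjacent quadratic pieces match in value at the common knot; they match in slope by the
definition of `spanCurvature`. -/
lemma knotValue_succ {ξ : ℕ → ℝ} (c : ℕ → ℝ) {j : ℕ} (hl : ξ (j + 1) ≤ ξ (j + 2))
    (hab : ξ (j + 2) < ξ (j + 3)) (hr : ξ (j + 3) ≤ ξ (j + 4)) :
    knotValue ξ c (j + 1) = knotValue ξ c j + knotSlope ξ c j * (ξ (j + 3) - ξ (j + 2))
      + spanCurvature ξ c j / 2 * (ξ (j + 3) - ξ (j + 2)) ^ 2 := by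
  have h1 : ξ (j + 3) - ξ (j + 2) ≠ 0 := (sub_pos.2 hab).ne'
  have h2 : ξ (j + 3) - ξ (j + 1) ≠ 0 := (show 0 < ξ (j + 3) - ξ (j + 1) by linarith).ne'
  have h3 : ξ (j + 4) - ξ (j + 2) ≠ 0 := (show 0 < ξ (j + 4) - ξ (j + 2) by linarith).ne'
  simp only [knotValue, spanCurvature, knotSlope, add_assoc, Nat.reduceAdd]
  field_simp
  ring

/-- The class in `L²(0,1)` of the indicator function of the knot span `(ξ (j + 2), ξ (j + 3))`. -/
def spanIndicator (ξ : ℕ → ℝ) (j : ℕ) : L2 :=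
  (memLp_indicator_const 2 (measurableSet_Ioo (a := ξ (j + 2)) (b := ξ (j + 3))) (1 : ℝ)
    (Or.inr (measure_ne_top mu _))).toLp _

lemma spanIndicator_ae_eq (ξ : ℕ → ℝ) (j : ℕ) :
    spanIndicator ξ j =ᵐ[mu] indicator (Ioo (ξ (j + 2)) (ξ (j + 3))) fun _ => (1 : ℝ) :=
  MemLp.coeFn_toLp _

/-- The second derivative of the spline with coefficients `c`. -/
def splineStep (n : ℕ) (ξ c : ℕ → ℝ) : L2 :=
  ∑ j ∈ Finset.range n, spanCurvature ξ c j • spanIndicator ξ j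

lemma splineStep_add (n : ℕ) (ξ c d : ℕ → ℝ) :
    splineStep n ξ (c + d) = splineStep n ξ c + splineStep n ξ d := by
  rw [splineStep, splineStep, splineStep, ← Finset.sum_add_distrib]
  refine Finset.sum_congr rfl fun j _ => ?_
  rw [← add_smul]
  congr 1
  simp only [spanCurvature, knotSlope, Pi.add_apply]
  ring

lemma splineStep_smul (n : ℕ) (ξ : ℕ → ℝ) (k : ℝ) (c : ℕ → ℝ) :
    splineStep n ξ (k • c) = k • splineStep n ξ c := by
  rw [splineStep, splineStep, Finset.smul_sum]
  refine Finset.sum_congr rfl fun j _ => ?_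
  rw [smul_smul]
  congr 1
  simp only [spanCurvature, knotSlope, Pi.smul_apply, smul_eq_mul]
  ring

lemma extZero_splineStep {n : ℕ} {ξ : ℕ → ℝ} (h : IsOpenKnotVector 2 (n + 2) ξ) (c : ℕ → ℝ)
    {j : ℕ} (hj : j < n) : ∀ᵐ t, t ∈ Ioo (ξ (j + 2)) (ξ (j + 3)) →
      extZero (splineStep n ξ c) t = spanCurvature ξ c j := by
  have h1 : splineStep n ξ c =ᵐ[mu] fun t => ∑ j ∈ Finset.range n,
      spanCurvature ξ c j * indicator (Ioo (ξ (j + 2)) (ξ (j + 3))) (fun _ => (1 : ℝ)) t := by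
    filter_upwards [ae_all_iff.2 fun i => spanIndicator_ae_eq ξ i,
      ae_all_iff.2 fun i => Lp.coeFn_smul (spanCurvature ξ c i) (spanIndicator ξ i),
      Lp.coeFn_finsetSum (Finset.range n) fun i => spanCurvature ξ c i • spanIndicator ξ i]
      with t h1 h2 h3
    rw [splineStep, h3, Finset.sum_apply]
    refine Finset.sum_congr rfl fun i _ => ?_
    rw [h2, Pi.smul_apply, h1, smul_eq_mul]
  filter_upwards [extZero_congr h1] with t ht htj
  have h01 : t ∈ Ioo (0 : ℝ) 1 := ⟨(h.mem_Icc (by omega)).1.trans_lt htj.1,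
    htj.2.trans_le (h.mem_Icc (by omega)).2⟩
  rw [ht, indicator_of_mem h01, Finset.sum_eq_single j, indicator_of_mem htj, mul_one]
  · intro i hi hij
    rw [Finset.mem_range] at hi
    refine mul_eq_zero_of_right _ (indicator_of_notMem (fun hh => ?_) _)
    rcases lt_or_gt_of_ne hij with h' | h'
    · have : ξ (i + 3) ≤ ξ (j + 2) := h.le (by omega) (by omega)
      linarith [hh.2, htj.1]
    · have : ξ (j + 3) ≤ ξ (i + 2) := h.le (by omega) (by omega)
      linarith [hh.1, htj.2]
  · intro hh
    exact absurd (Finset.mem_range.2 hj) hh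

lemma intervalIntegral_congr_Ioo {f g : ℝ → ℝ} {a b : ℝ} (hab : a ≤ b)
    (h : ∀ᵐ t, t ∈ Ioo a b → f t = g t) : ∫ t in a..b, f t = ∫ t in a..b, g t := by
  rw [intervalIntegral.integral_of_le hab, intervalIntegral.integral_of_le hab,
    integral_Ioc_eq_integral_Ioo, integral_Ioc_eq_integral_Ioo]
  exact integral_congr_ae ((ae_restrict_iff' measurableSet_Ioo).2 h)

/-! ### Primitives and energy on an interval where the density is constant. -/

section ConstantPiece

variable {g : L2} {a b D : ℝ}

lemma prim_of_const (hg : ∀ᵐ t, t ∈ Ioo a b → extZero g t = D) {x : ℝ} (hx : x ∈ Icc a b) :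
    prim g x = prim g a + D * (x - a) := by
  rw [prim_eq g x a, intervalIntegral_congr_Ioo (g := fun _ => D) hx.1 (by
    filter_upwards [hg] with t ht ht' using ht ⟨ht'.1, ht'.2.trans_le hx.2⟩)]
  rw [intervalIntegral.integral_const, smul_eq_mul]
  ring

lemma prim₂_of_const (hg : ∀ᵐ t, t ∈ Ioo a b → extZero g t = D) {x : ℝ} (hx : x ∈ Icc a b) :
    prim₂ g x = prim₂ g a + prim g a * (x - a) + D / 2 * (x - a) ^ 2 := by
  rw [prim₂_eq g x a, intervalIntegral_congr_Ioo (g := fun t => (x - t) * D) hx.1 (by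
    filter_upwards [hg] with t ht ht'
    rw [ht ⟨ht'.1, ht'.2.trans_le hx.2⟩])]
  rw [intervalIntegral.integral_mul_const, intervalIntegral.integral_sub (by simp) (by simp),
    intervalIntegral.integral_const, integral_id, smul_eq_mul]
  ring

lemma energy_of_const (hg : ∀ᵐ t, t ∈ Ioo a b → extZero g t = D) (hab : a ≤ b) :
    energy g a b = D ^ 2 * (b - a) := by
  rw [energy, intervalIntegral_congr_Ioo (g := fun _ => D ^ 2) hab (by
    filter_upwards [hg] with t ht ht'
    rw [ht ht'])]
  rw [intervalIntegral.integral_const, smul_eq_mul]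
  ring

end ConstantPiece

/-- The vanishing of `c 0` and `c 1` makes value and slope of the spline zero at `0`, as for the
primitives; integrating the step function span by span propagates the agreement. -/
lemma prim_splineStep {n : ℕ} {ξ : ℕ → ℝ} (h : IsOpenKnotVector 2 (n + 2) ξ)
    (hs : ∀ j < n, ξ (j + 2) < ξ (j + 3)) {c : ℕ → ℝ} (h0 : c 0 = 0) (h1 : c 1 = 0)
    {j : ℕ} (hj : j ≤ n) :
    prim (splineStep n ξ c) (ξ (j + 2)) = knotSlope ξ c j ∧
      prim₂ (splineStep n ξ c) (ξ (j + 2)) = knotValue ξ c j := by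
  induction j with
  | zero => simp [h.left 2 le_rfl, knotSlope, knotValue, h0, h1]
  | succ j ih =>
    obtain ⟨e1, e2⟩ := ih (by omega)
    have hab := hs j (by omega)
    have hg := extZero_splineStep h c (show j < n by omega)
    constructor
    · rw [prim_of_const hg ⟨hab.le, le_rfl⟩, e1, spanCurvature]
      field_simp [(sub_pos.2 hab).ne']
      ring
    · rw [knotValue_succ c (h.mono _ (by omega)) hab (h.mono _ (by omega)),
        prim₂_of_const hg ⟨hab.le, le_rfl⟩, e1, e2]

lemma prim₂_splineStep_eq {n : ℕ} {ξ : ℕ → ℝ} (h : IsOpenKnotVector 2 (n + 2) ξ)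
    (hs : ∀ j < n, ξ (j + 2) < ξ (j + 3)) {c : ℕ → ℝ} (h0 : c 0 = 0) (h1 : c 1 = 0)
    {j : ℕ} (hj : j < n) {x : ℝ} (hx : x ∈ Icc (ξ (j + 2)) (ξ (j + 3))) :
    prim₂ (splineStep n ξ c) x
      = quadSpline (ξ (j + 1)) (ξ (j + 2)) (ξ (j + 3)) (ξ (j + 4)) (c j) (c (j + 1))
          (c (j + 2)) x := by
  obtain ⟨e1, e2⟩ := prim_splineStep h hs h0 h1 hj.le
  rw [quadSpline_eq (h.mono _ (by omega)) (hs j hj) (h.mono _ (by omega)),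
    prim₂_of_const (extZero_splineStep h c hj) hx, e1, e2]
  rfl

lemma prim₂_splineStep_eq_sum {n : ℕ} {ξ : ℕ → ℝ} (h : IsOpenKnotVector 2 (n + 2) ξ)
    (hs : ∀ j < n, ξ (j + 2) < ξ (j + 3)) {c : ℕ → ℝ} (h0 : c 0 = 0) (h1 : c 1 = 0)
    {x : ℝ} (hx : x ∈ Ico (0 : ℝ) 1) :
    prim₂ (splineStep n ξ c) x = ∑ i ∈ Finset.range (n + 2), c i * bspline ξ 2 i x := by
  obtain ⟨j, hj, hxj⟩ := exists_mem_knot_Ico h hx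
  rw [sum_bspline_eq h c hj hxj, prim₂_splineStep_eq h hs h0 h1 hj (Ico_subset_Icc_self hxj)]

/-- The last two coefficients determine value and slope of the spline at `1`, so the boundary
conditions there hold. -/
lemma splineStep_moments {n : ℕ} {ξ : ℕ → ℝ} (h : IsOpenKnotVector 2 (n + 2) ξ)
    (hs : ∀ j < n, ξ (j + 2) < ξ (j + 3)) {c : ℕ → ℝ} (h0 : c 0 = 0) (h1 : c 1 = 0)
    (hn : c n = 0) (hn1 : c (n + 1) = 0) :
    prim (splineStep n ξ c) 1 = 0 ∧ prim₂ (splineStep n ξ c) 1 = 0 := by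
  have := prim_splineStep h hs h0 h1 (le_refl n)
  rw [h.right (n + 2) le_rfl (by omega)] at this
  rw [this.1, this.2]
  simp [knotSlope, knotValue, hn, hn1]

/-! ### The coefficient functionals -/

/-- The midpoint of the middle knot span of the `i`-th quadratic B-spline. -/
def greville (ξ : ℕ → ℝ) (i : ℕ) : ℝ := (ξ (i + 1) + ξ (i + 2)) / 2

/-- The coefficients of the quasi-interpolant of `prim₂ g`; those of the B-splines that violate
the boundary conditions are zero. -/
def splineCoef (n : ℕ) (ξ : ℕ → ℝ) (g : L2) (i : ℕ) : ℝ :=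
  if 2 ≤ i ∧ i < n then
    -- For a quadratic this is the polar form at the two ends of the span: `x²` gives the product of
    -- the ends.
    2 * prim₂ g (greville ξ i) - (prim₂ g (ξ (i + 1)) + prim₂ g (ξ (i + 2))) / 2
  else 0

lemma splineCoef_add (n : ℕ) (ξ : ℕ → ℝ) (g h : L2) :
    splineCoef n ξ (g + h) = splineCoef n ξ g + splineCoef n ξ h := by
  ext i
  simp only [splineCoef, prim₂_add, Pi.add_apply]
  split_ifs <;> ring

lemma splineCoef_smul (n : ℕ) (ξ : ℕ → ℝ) (c : ℝ) (g : L2) :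
    splineCoef n ξ (c • g) = c • splineCoef n ξ g := by
  ext i
  simp only [splineCoef, prim₂_smul, Pi.smul_apply, smul_eq_mul]
  split_ifs <;> ring

lemma splineCoef_of_lt_two (n : ℕ) (ξ : ℕ → ℝ) (g : L2) {i : ℕ} (hi : i < 2) :
    splineCoef n ξ g i = 0 := if_neg (by omega)

lemma splineCoef_of_le (n : ℕ) (ξ : ℕ → ℝ) (g : L2) {i : ℕ} (hi : n ≤ i) :
    splineCoef n ξ g i = 0 := if_neg (by omega)

/-! ### Local and global estimates for the quasi-interpolant. -/

section Estimates

variable {n : ℕ} {ξ : ℕ → ℝ} {H : ℝ} {g : L2}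

lemma sq_prim₂_sub_le_of_le {a b x y : ℝ} (hx : x ∈ Icc a b) (hy : y ∈ Icc a b)
    (hH : |x - y| ≤ H) :
    (prim₂ g x - (prim₂ g y + prim g y * (x - y))) ^ 2 ≤ H ^ 3 * energy g a b := by
  refine (sq_prim₂_sub_le g hx hy).trans ?_
  have := energy_nonneg g (hx.1.trans hx.2)
  gcongr

/-- For an interior coefficient the difference is a symmetric second difference about the midpoint,
so the linear Taylor terms cancel. A boundary coefficient is zero, and so is the Taylor polynomial
of `prim₂ g` at the end point `0` or `1`. -/
lemma sq_splineCoef_sub_le (h : IsOpenKnotVector 2 (n + 2) ξ)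
    (hH : ∀ i < n + 4, ξ (i + 1) - ξ i ≤ H) (hg1 : prim g 1 = 0) (hg2 : prim₂ g 1 = 0)
    {i : ℕ} (hi : i < n + 2) :
    (splineCoef n ξ g i - prim₂ g (greville ξ i)) ^ 2
      ≤ H ^ 3 * energy g (ξ (i + 1)) (ξ (i + 2)) := by
  have hab : ξ (i + 1) ≤ ξ (i + 2) := h.mono _ (by omega)
  have hh := hH (i + 1) (by omega)
  change ξ (i + 2) - ξ (i + 1) ≤ H at hh
  set a := ξ (i + 1)
  set b := ξ (i + 2)
  have hm : greville ξ i ∈ Icc a b := by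
    rw [greville]
    constructor <;> linarith
  have hma : |a - greville ξ i| ≤ H := abs_le.2 ⟨by linarith [hm.2], by linarith [hm.1]⟩
  have hmb : |b - greville ξ i| ≤ H := abs_le.2 ⟨by linarith [hm.2], by linarith [hm.1, hm.2]⟩
  by_cases hc : 2 ≤ i ∧ i < n
  · have t1 := sq_prim₂_sub_le_of_le (g := g) (H := H) ⟨le_rfl, hab⟩ hm hma
    have t2 := sq_prim₂_sub_le_of_le (g := g) (H := H) ⟨hab, le_rfl⟩ hm hmb
    rw [splineCoef, if_pos hc]
    set r1 := prim₂ g a - (prim₂ g (greville ξ i) + prim g (greville ξ i) * (a - greville ξ i))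
    set r2 := prim₂ g b - (prim₂ g (greville ξ i) + prim g (greville ξ i) * (b - greville ξ i))
    have e : 2 * prim₂ g (greville ξ i) - (prim₂ g a + prim₂ g b) / 2 - prim₂ g (greville ξ i)
        = -(r1 + r2) / 2 := by
      have : greville ξ i = (a + b) / 2 := rfl
      simp only [r1, r2]
      linear_combination prim g (greville ξ i) * this
    rw [e]
    nlinarith [sq_nonneg (r1 - r2)]
  · rw [splineCoef, if_neg hc, zero_sub, neg_sq]
    rcases lt_or_ge i 2 with h2 | h2
    · have ha : a = 0 := h.left _ (by omega)
      have t := sq_prim₂_sub_le_of_le (g := g) (H := H) hm ⟨le_rfl, hab⟩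
        (by rwa [abs_sub_comm])
      rw [ha] at t ⊢
      simpa using t
    · have hb : b = 1 := h.right _ (by omega) (by omega)
      have t := sq_prim₂_sub_le_of_le (g := g) (H := H) hm ⟨hab, le_rfl⟩
        (by rwa [abs_sub_comm])
      rw [hb, hg1, hg2] at t
      rw [hb]
      simpa using t

/-- The first order Taylor polynomial of `prim₂ g` at the knot `ξ (j + 2)`. -/
def knotTaylor (ξ : ℕ → ℝ) (g : L2) (j : ℕ) (x : ℝ) : ℝ :=
  prim₂ g (ξ (j + 2)) + prim g (ξ (j + 2)) * (x - ξ (j + 2))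

lemma sq_splineCoef_sub_taylor_le (h : IsOpenKnotVector 2 (n + 2) ξ)
    (hH : ∀ i < n + 4, ξ (i + 1) - ξ i ≤ H) (hg1 : prim g 1 = 0) (hg2 : prim₂ g 1 = 0)
    {j : ℕ} (hj : j < n) {i : ℕ} (hij : j ≤ i) (hij' : i ≤ j + 2) :
    (splineCoef n ξ g i - knotTaylor ξ g j (greville ξ i)) ^ 2
      ≤ 18 * H ^ 3 * energy g (ξ (j + 1)) (ξ (j + 4)) := by
  have t1 := sq_splineCoef_sub_le h hH hg1 hg2 (show i < n + 2 by omega)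
  have hl : ξ (j + 1) ≤ ξ (i + 1) := h.le (by omega) (by omega)
  have hr : ξ (i + 2) ≤ ξ (j + 4) := h.le (by omega) (by omega)
  have hi : ξ (i + 1) ≤ ξ (i + 2) := h.mono _ (by omega)
  have h1 := hH (j + 1) (by omega)
  have h2 := hH (j + 2) (by omega)
  have h3 := hH (j + 3) (by omega)
  have m1 := h.mono (j + 1) (by omega)
  have m2 := h.mono (j + 2) (by omega)
  have m3 := h.mono (j + 3) (by omega)
  simp only [add_assoc, Nat.reduceAdd] at h1 h2 h3 m1 m2 m3
  have hm : greville ξ i ∈ Icc (ξ (j + 1)) (ξ (j + 4)) := by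
    rw [greville]
    constructor <;> linarith
  have t2 := sq_prim₂_sub_le_of_le (g := g) (H := 2 * H) (y := ξ (j + 2)) hm
    ⟨m1, m2.trans m3⟩ (abs_le.2 ⟨by linarith [hm.1], by linarith [hm.2]⟩)
  have hE := energy_mono g hl hr
  have hH0 : 0 ≤ H := by linarith
  have t3 : H ^ 3 * energy g (ξ (i + 1)) (ξ (i + 2))
      ≤ H ^ 3 * energy g (ξ (j + 1)) (ξ (j + 4)) := by gcongr
  rw [knotTaylor]
  set p := splineCoef n ξ g i
  set q := prim₂ g (greville ξ i)
  set s := prim₂ g (ξ (j + 2)) + prim g (ξ (j + 2)) * (greville ξ i - ξ (j + 2))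
  -- The factor is `18 = 2 (1 + 8)`, the `8` being `2 ^ 3` from the Taylor bound over distance `2 *
  -- H`.
  nlinarith [sq_nonneg ((p - q) - (q - s))]

/-- Quadratic splines reproduce affine functions, with coefficients their values at the midpoints of
consecutive spans. -/
lemma quadSpline_sub_taylor {l a b r : ℝ} (hl : l ≤ a) (hab : a < b) (hr : b ≤ r)
    (c₀ c₁ c₂ A B x : ℝ) :
    quadSpline l a b r c₀ c₁ c₂ x - (A + B * (x - a))
      = quadSpline l a b r (c₀ - (A + B * ((l + a) / 2 - a))) (c₁ - (A + B * ((a + b) / 2 - a)))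
          (c₂ - (A + B * ((b + r) / 2 - a))) x := by
  have h1 : b - a ≠ 0 := (sub_pos.2 hab).ne'
  have h2 : b - l ≠ 0 := (show 0 < b - l by linarith).ne'
  have h3 : r - a ≠ 0 := (show 0 < r - a by linarith).ne'
  rw [quadSpline, quadSpline]
  field_simp
  ring

/-- On the span the three weights are nonnegative and sum to `1`. -/
lemma abs_quadSpline_le {l a b r c₀ c₁ c₂ η x : ℝ} (hl : l ≤ a) (hab : a < b) (hr : b ≤ r)
    (h0 : |c₀| ≤ η) (h1 : |c₁| ≤ η) (h2 : |c₂| ≤ η) (hx : x ∈ Icc a b) :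
    |quadSpline l a b r c₀ c₁ c₂ x| ≤ η := by
  have d1 : 0 < b - a := sub_pos.2 hab
  have d2 : 0 < b - l := by linarith
  have d3 : 0 < r - a := by linarith
  obtain ⟨hx1, hx2⟩ := hx
  have w0 : 0 ≤ (b - x) / (b - l) * ((b - x) / (b - a)) :=
    mul_nonneg (div_nonneg (by linarith) d2.le) (div_nonneg (by linarith) d1.le)
  have w2 : 0 ≤ (x - a) / (r - a) * ((x - a) / (b - a)) :=
    mul_nonneg (div_nonneg (by linarith) d3.le) (div_nonneg (by linarith) d1.le)
  have w1 : 0 ≤ (x - l) / (b - l) * ((b - x) / (b - a))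
      + (r - x) / (r - a) * ((x - a) / (b - a)) :=
    add_nonneg (mul_nonneg (div_nonneg (by linarith) d2.le) (div_nonneg (by linarith) d1.le))
      (mul_nonneg (div_nonneg (by linarith) d3.le) (div_nonneg (by linarith) d1.le))
  have hsum : (b - x) / (b - l) * ((b - x) / (b - a)) + ((x - l) / (b - l) * ((b - x) / (b - a))
      + (r - x) / (r - a) * ((x - a) / (b - a))) + (x - a) / (r - a) * ((x - a) / (b - a))
      = 1 := by
    field_simp
    ring
  rw [quadSpline]
  set p := (b - x) / (b - l) * ((b - x) / (b - a))
  set q := (x - l) / (b - l) * ((b - x) / (b - a)) + (r - x) / (r - a) * ((x - a) / (b - a))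
  set s := (x - a) / (r - a) * ((x - a) / (b - a))
  calc |c₀ * p + c₁ * q + c₂ * s| ≤ |c₀| * p + |c₁| * q + |c₂| * s := by
        refine (abs_add_three _ _ _).trans_eq ?_
        rw [abs_mul c₀, abs_mul c₁, abs_mul c₂, abs_of_nonneg w0, abs_of_nonneg w1, abs_of_nonneg w2]
    _ ≤ η * p + η * q + η * s := by gcongr
    _ = η := by rw [← mul_add, ← mul_add, hsum, mul_one]

/-- An affine function has no second derivative, so only the deviations `e₀, e₁, e₂` contribute. The
length ratios are at most `1`, which bounds the second difference by `8 * η`. -/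
lemma sq_mul_le_of_coef_le {l a b r c₀ c₁ c₂ A B η : ℝ} (hl : l ≤ a) (hab : a < b)
    (hr : b ≤ r) (h0 : |c₀ - (A + B * ((l + a) / 2 - a))| ≤ η)
    (h1 : |c₁ - (A + B * ((a + b) / 2 - a))| ≤ η)
    (h2 : |c₂ - (A + B * ((b + r) / 2 - a))| ≤ η) :
    ((2 * (c₂ - c₁) / (r - a) - 2 * (c₁ - c₀) / (b - l)) / (b - a)) ^ 2 * (b - a) ^ 4
      ≤ 64 * η ^ 2 := by
  have d1 : 0 < b - a := sub_pos.2 hab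
  have d2 : 0 < b - l := by linarith
  have d3 : 0 < r - a := by linarith
  set e₀ := c₀ - (A + B * ((l + a) / 2 - a))
  set e₁ := c₁ - (A + B * ((a + b) / 2 - a))
  set e₂ := c₂ - (A + B * ((b + r) / 2 - a))
  have e : (2 * (c₂ - c₁) / (r - a) - 2 * (c₁ - c₀) / (b - l)) / (b - a) * (b - a) ^ 2
      = 2 * (e₂ - e₁) * ((b - a) / (r - a)) - 2 * (e₁ - e₀) * ((b - a) / (b - l)) := by
    simp only [e₀, e₁, e₂]
    field_simp
    ring
  have q1 : (b - a) / (r - a) ≤ 1 := (div_le_one d3).2 (by linarith)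
  have q2 : (b - a) / (b - l) ≤ 1 := (div_le_one d2).2 (by linarith)
  have q1' : 0 ≤ (b - a) / (r - a) := by positivity
  have q2' : 0 ≤ (b - a) / (b - l) := by positivity
  have hη : 0 ≤ η := (abs_nonneg _).trans h0
  have hab' : |2 * (e₂ - e₁) * ((b - a) / (r - a)) - 2 * (e₁ - e₀) * ((b - a) / (b - l))|
      ≤ 8 * η := by
    have b1 : |2 * (e₂ - e₁)| ≤ 4 * η := by
      rw [abs_le] at h1 h2 ⊢
      constructor <;> linarith [h1.1, h1.2, h2.1, h2.2]
    have b2 : |2 * (e₁ - e₀)| ≤ 4 * η := by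
      rw [abs_le] at h0 h1 ⊢
      constructor <;> linarith [h1.1, h1.2, h0.1, h0.2]
    refine (abs_sub _ _).trans ?_
    rw [abs_mul, abs_mul (2 * (e₁ - e₀)), abs_of_nonneg q1', abs_of_nonneg q2']
    have := mul_le_mul b1 q1 q1' (by positivity)
    have := mul_le_mul b2 q2 q2' (by positivity)
    linarith
  calc _ = ((2 * (c₂ - c₁) / (r - a) - 2 * (c₁ - c₀) / (b - l)) / (b - a) * (b - a) ^ 2) ^ 2 := by
        ring
    _ = |2 * (e₂ - e₁) * ((b - a) / (r - a)) - 2 * (e₁ - e₀) * ((b - a) / (b - l))| ^ 2 := by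
        rw [e, sq_abs]
    _ ≤ (8 * η) ^ 2 := by gcongr
    _ = _ := by ring

lemma abs_splineCoef_sub_taylor_le (h : IsOpenKnotVector 2 (n + 2) ξ)
    (hH : ∀ i < n + 4, ξ (i + 1) - ξ i ≤ H) (hg1 : prim g 1 = 0) (hg2 : prim₂ g 1 = 0)
    {j : ℕ} (hj : j < n) {i : ℕ} (hij : j ≤ i) (hij' : i ≤ j + 2) :
    |splineCoef n ξ g i - knotTaylor ξ g j (greville ξ i)|
      ≤ √(18 * H ^ 3 * energy g (ξ (j + 1)) (ξ (j + 4))) :=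
  Real.abs_le_sqrt (sq_splineCoef_sub_taylor_le h hH hg1 hg2 hj hij hij')

lemma coef_energy_nonneg (h : IsOpenKnotVector 2 (n + 2) ξ)
    (hH : ∀ i < n + 4, ξ (i + 1) - ξ i ≤ H) {j : ℕ} (hj : j < n) :
    0 ≤ H ∧ 0 ≤ energy g (ξ (j + 1)) (ξ (j + 4)) := by
  have h1 := hH 0 (by omega)
  have h2 := h.mono 0 (by omega)
  exact ⟨by linarith, energy_nonneg g (h.le (by omega) (by omega))⟩

/-- Local approximation property of the quasi-interpolant. -/
lemma sq_prim₂_sub_splineStep_le (h : IsOpenKnotVector 2 (n + 2) ξ)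
    (hs : ∀ j < n, ξ (j + 2) < ξ (j + 3)) (hH : ∀ i < n + 4, ξ (i + 1) - ξ i ≤ H)
    (hg1 : prim g 1 = 0) (hg2 : prim₂ g 1 = 0) {j : ℕ} (hj : j < n) {x : ℝ}
    (hx : x ∈ Icc (ξ (j + 2)) (ξ (j + 3))) :
    (prim₂ g x - prim₂ (splineStep n ξ (splineCoef n ξ g)) x) ^ 2
      ≤ 38 * H ^ 3 * energy g (ξ (j + 1)) (ξ (j + 4)) := by
  obtain ⟨hH0, hE⟩ := coef_energy_nonneg (g := g) h hH hj
  have m1 : ξ (j + 1) ≤ ξ (j + 2) := h.mono _ (by omega)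
  have m3 : ξ (j + 3) ≤ ξ (j + 4) := h.mono _ (by omega)
  have h2 : ξ (j + 3) - ξ (j + 2) ≤ H := hH (j + 2) (by omega)
  have t := sq_prim₂_sub_le_of_le (g := g) (H := H) (x := x) (y := ξ (j + 2))
    (⟨m1.trans hx.1, hx.2.trans m3⟩ : x ∈ Icc (ξ (j + 1)) (ξ (j + 4)))
    ⟨m1, (hs j hj).le.trans m3⟩ (abs_le.2 ⟨by linarith [hx.1], by linarith [hx.2]⟩)
  have q := abs_quadSpline_le m1 (hs j hj) m3
    (abs_splineCoef_sub_taylor_le h hH hg1 hg2 hj le_rfl (by omega))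
    (abs_splineCoef_sub_taylor_le h hH hg1 hg2 hj (show j ≤ j + 1 by omega) (by omega))
    (abs_splineCoef_sub_taylor_le h hH hg1 hg2 hj (show j ≤ j + 2 by omega) le_rfl) hx
  have e := quadSpline_sub_taylor m1 (hs j hj) m3 (splineCoef n ξ g j) (splineCoef n ξ g (j + 1))
    (splineCoef n ξ g (j + 2)) (prim₂ g (ξ (j + 2))) (prim g (ξ (j + 2))) x
  simp only [knotTaylor, greville, add_assoc, Nat.reduceAdd] at q
  rw [← e, ← prim₂_splineStep_eq h hs (splineCoef_of_lt_two n ξ g (by omega))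
    (splineCoef_of_lt_two n ξ g (by omega)) hj hx] at q
  have q2 := pow_le_pow_left₀ (abs_nonneg _) q 2
  rw [sq_abs, Real.sq_sqrt (by positivity)] at q2
  set p := prim₂ g x
  set s := prim₂ (splineStep n ξ (splineCoef n ξ g)) x
  set w := prim₂ g (ξ (j + 2)) + prim g (ξ (j + 2)) * (x - ξ (j + 2))
  -- Here `38 = 2 (1 + 18)`: Taylor error of `prim₂ g` plus deviation of the spline from the Taylor
  -- polynomial.
  nlinarith [sq_nonneg ((p - w) + (s - w))]

/-- Local stability of the quasi-interpolant. -/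
lemma energy_splineStep_le (h : IsOpenKnotVector 2 (n + 2) ξ)
    (hs : ∀ j < n, ξ (j + 2) < ξ (j + 3)) (hH : ∀ i < n + 4, ξ (i + 1) - ξ i ≤ H)
    (hg1 : prim g 1 = 0) (hg2 : prim₂ g 1 = 0) {cQ : ℝ} (hcQ : 0 < cQ) {j : ℕ} (hj : j < n)
    (hq : cQ * H ≤ ξ (j + 3) - ξ (j + 2)) :
    energy (splineStep n ξ (splineCoef n ξ g)) (ξ (j + 2)) (ξ (j + 3))
      ≤ 1152 / cQ ^ 3 * energy g (ξ (j + 1)) (ξ (j + 4)) := by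
  obtain ⟨hH0, hE⟩ := coef_energy_nonneg (g := g) h hH hj
  have m1 : ξ (j + 1) ≤ ξ (j + 2) := h.mono _ (by omega)
  have m3 : ξ (j + 3) ≤ ξ (j + 4) := h.mono _ (by omega)
  have h2 : ξ (j + 3) - ξ (j + 2) ≤ H := hH (j + 2) (by omega)
  have hd : 0 < ξ (j + 3) - ξ (j + 2) := sub_pos.2 (hs j hj)
  have hHpos : 0 < H := hd.trans_le h2
  have t := sq_mul_le_of_coef_le m1 (hs j hj) m3
    (abs_splineCoef_sub_taylor_le h hH hg1 hg2 hj le_rfl (by omega))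
    (abs_splineCoef_sub_taylor_le h hH hg1 hg2 hj (show j ≤ j + 1 by omega) (by omega))
    (abs_splineCoef_sub_taylor_le h hH hg1 hg2 hj (show j ≤ j + 2 by omega) le_rfl)
  rw [Real.sq_sqrt (by positivity)] at t
  rw [energy_of_const (extZero_splineStep h _ hj) (hs j hj).le]
  change spanCurvature ξ (splineCoef n ξ g) j ^ 2 * _ ≤ _ at t
  set D := spanCurvature ξ (splineCoef n ξ g) j
  set d := ξ (j + 3) - ξ (j + 2)
  set E := energy g (ξ (j + 1)) (ξ (j + 4))
  rw [div_mul_eq_mul_div, le_div_iff₀ (by positivity)]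
  -- Quasi-uniformity absorbs the `H ^ 3` of the coefficient bound into the span length; `1152 = 64
  -- * 18`.
  have hp : cQ ^ 3 * H ^ 3 ≤ d ^ 3 := by
    rw [← mul_pow]
    gcongr
  have : D ^ 2 * d * (cQ ^ 3 * H ^ 3) ≤ 1152 * E * H ^ 3 :=
    calc _ ≤ D ^ 2 * d * d ^ 3 := by gcongr
      _ = D ^ 2 * d ^ 4 := by ring
      _ ≤ _ := t
      _ = _ := by ring
  refine le_of_mul_le_mul_right ?_ (show 0 < H ^ 3 by positivity)
  linarith

lemma sum_energy (ξ : ℕ → ℝ) (g : L2) (i m : ℕ) :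
    ∑ j ∈ Finset.range m, energy g (ξ (j + i)) (ξ (j + i + 1)) = energy g (ξ i) (ξ (m + i)) := by
  induction m with
  | zero => simp [energy]
  | succ m ih =>
    rw [Finset.sum_range_succ, ih, energy_add, add_right_comm]

/-- Each patch consists of three consecutive spans, so the sum splits into three shifted sums, each
at most the full norm. -/
lemma sum_patch_energy_le (h : IsOpenKnotVector 2 (n + 2) ξ) (g : L2) :
    ∑ j ∈ Finset.range n, energy g (ξ (j + 1)) (ξ (j + 4)) ≤ 3 * ‖g‖ ^ 2 := by
  have e : ∀ j, energy g (ξ (j + 1)) (ξ (j + 4)) = energy g (ξ (j + 1)) (ξ (j + 1 + 1))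
      + energy g (ξ (j + 2)) (ξ (j + 2 + 1)) + energy g (ξ (j + 3)) (ξ (j + 3 + 1)) := fun j => by
    rw [energy_add, energy_add]
  simp only [e, Finset.sum_add_distrib]
  rw [sum_energy, sum_energy, sum_energy]
  have h1 := energy_le g (h.le (show 1 ≤ n + 1 by omega) (by omega))
  have h2 := energy_le g (h.le (show 2 ≤ n + 2 by omega) (by omega))
  have h3 := energy_le g (h.le (show 3 ≤ n + 3 by omega) (by omega))
  linarith

lemma norm_splineStep_sq_le (h : IsOpenKnotVector 2 (n + 2) ξ)
    (hs : ∀ j < n, ξ (j + 2) < ξ (j + 3)) (hH : ∀ i < n + 4, ξ (i + 1) - ξ i ≤ H)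
    (hg1 : prim g 1 = 0) (hg2 : prim₂ g 1 = 0) {cQ : ℝ} (hcQ : 0 < cQ)
    (hq : ∀ j < n, cQ * H ≤ ξ (j + 3) - ξ (j + 2)) :
    ‖splineStep n ξ (splineCoef n ξ g)‖ ^ 2 ≤ 3456 / cQ ^ 3 * ‖g‖ ^ 2 := by
  have e := sum_energy ξ (splineStep n ξ (splineCoef n ξ g)) 2 n
  rw [h.left 2 le_rfl, h.right (n + 2) le_rfl (by omega)] at e
  rw [norm_sq_eq_intervalIntegral]
  change energy _ 0 1 ≤ _
  rw [← e]
  calc _ ≤ ∑ j ∈ Finset.range n, 1152 / cQ ^ 3 * energy g (ξ (j + 1)) (ξ (j + 4)) :=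
        Finset.sum_le_sum fun j hj => energy_splineStep_le h hs hH hg1 hg2 hcQ
          (Finset.mem_range.1 hj) (hq j (Finset.mem_range.1 hj))
    _ ≤ 1152 / cQ ^ 3 * (3 * ‖g‖ ^ 2) := by
        rw [← Finset.mul_sum]
        gcongr
        exact sum_patch_energy_le h g
    _ = _ := by ring

/-- Integrating the pointwise bound over a span of length at most `H` gains the fourth power of `H`;
the overlap gives `114 = 3 * 38`. -/
lemma norm_primL₂_sub_sq_le (h : IsOpenKnotVector 2 (n + 2) ξ)
    (hs : ∀ j < n, ξ (j + 2) < ξ (j + 3)) (hH : ∀ i < n + 4, ξ (i + 1) - ξ i ≤ H)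
    (hg1 : prim g 1 = 0) (hg2 : prim₂ g 1 = 0) :
    ‖primL₂ g - primL₂ (splineStep n ξ (splineCoef n ξ g))‖ ^ 2 ≤ 114 * H ^ 4 * ‖g‖ ^ 2 := by
  set G := splineStep n ξ (splineCoef n ξ g)
  have hc : Continuous fun x => (prim₂ g x - prim₂ G x) ^ 2 :=
    ((continuous_prim₂ g).sub (continuous_prim₂ G)).pow 2
  have e1 : ‖primL₂ g - primL₂ G‖ ^ 2 = ∫ x in (0 : ℝ)..1, (prim₂ g x - prim₂ G x) ^ 2 := by
    rw [norm_sq_eq_integral, intervalIntegral.integral_of_le zero_le_one,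
      integral_Ioc_eq_integral_Ioo]
    refine integral_congr_ae ?_
    filter_upwards [Lp.coeFn_sub (primL₂ g) (primL₂ G), primL₂_ae_eq g, primL₂_ae_eq G]
      with x h1 h2 h3
    rw [h1, Pi.sub_apply, h2, h3]
  have e2 := intervalIntegral.sum_integral_adjacent_intervals (a := fun j => ξ (j + 2)) (n := n)
    (μ := volume) fun j _ => hc.intervalIntegrable (ξ (j + 2)) (ξ (j + 1 + 2))
  simp only [zero_add] at e2
  rw [h.left 2 le_rfl, h.right (n + 2) le_rfl (by omega)] at e2
  rw [e1, ← e2]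
  calc _ ≤ ∑ j ∈ Finset.range n, 38 * H ^ 4 * energy g (ξ (j + 1)) (ξ (j + 4)) := by
        refine Finset.sum_le_sum fun j hj => ?_
        rw [Finset.mem_range] at hj
        obtain ⟨hH0, hE⟩ := coef_energy_nonneg (g := g) h hH hj
        have hd := hs j hj
        have h2 : ξ (j + 3) - ξ (j + 2) ≤ H := hH (j + 2) (by omega)
        calc _ ≤ ∫ x in ξ (j + 2)..ξ (j + 3),
              38 * H ^ 3 * energy g (ξ (j + 1)) (ξ (j + 4)) :=
              intervalIntegral.integral_mono_on hd.le (hc.intervalIntegrable _ _) (by simp)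
                fun x hx => sq_prim₂_sub_splineStep_le h hs hH hg1 hg2 hj hx
          _ = (ξ (j + 3) - ξ (j + 2)) * (38 * H ^ 3 * energy g (ξ (j + 1)) (ξ (j + 4))) := by
              rw [intervalIntegral.integral_const, smul_eq_mul]
          _ ≤ H * (38 * H ^ 3 * energy g (ξ (j + 1)) (ξ (j + 4))) := by gcongr
          _ = _ := by ring
    _ ≤ 38 * H ^ 4 * (3 * ‖g‖ ^ 2) := by
        rw [← Finset.mul_sum]
        gcongr
        exact sum_patch_energy_le h g
    _ = _ := by ring

end Estimates

/-! ### The projector -/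

/-- Both sides are continuous, so the almost everywhere identity holds at every point of the closed
span, ends included. -/
lemma prim₂_eq_quadSpline {n : ℕ} {ξ : ℕ → ℝ} (h : IsOpenKnotVector 2 (n + 2) ξ)
    (hs : ∀ j < n, ξ (j + 2) < ξ (j + 3)) {g : L2} {c : ℕ → ℝ}
    (hg : primL₂ g =ᵐ[mu] fun x => ∑ i ∈ Finset.range (n + 2), c i * bspline ξ 2 i x)
    {j : ℕ} (hj : j < n) :
    EqOn (prim₂ g) (quadSpline (ξ (j + 1)) (ξ (j + 2)) (ξ (j + 3)) (ξ (j + 4)) (c j) (c (j + 1))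
      (c (j + 2))) (Icc (ξ (j + 2)) (ξ (j + 3))) := by
  have hq : Continuous (quadSpline (ξ (j + 1)) (ξ (j + 2)) (ξ (j + 3)) (ξ (j + 4)) (c j)
      (c (j + 1)) (c (j + 2))) := by
    unfold quadSpline
    fun_prop
  have h1 : EqOn (prim₂ g) (quadSpline (ξ (j + 1)) (ξ (j + 2)) (ξ (j + 3)) (ξ (j + 4)) (c j)
      (c (j + 1)) (c (j + 2))) (Ioo (ξ (j + 2)) (ξ (j + 3))) := by
    refine Measure.eqOn_Ioo_of_ae_eq (μ := volume) ?_ (continuous_prim₂ g).continuousOn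
      hq.continuousOn
    filter_upwards [ae_restrict_mono_mu ((primL₂_ae_eq g).symm.trans hg)
      (h.mem_Icc (i := j + 2) (by omega)).1 (h.mem_Icc (i := j + 3) (by omega)).2,
      ae_restrict_mem measurableSet_Ioo] with x hx hx'
    rw [hx, sum_bspline_eq h c hj (Ioo_subset_Ico_self hx')]
  rw [← closure_Ioo (hs j hj).ne]
  exact h1.closure (continuous_prim₂ g) hq

/-- At a repeated end knot the value is `c₀` and the slope is a multiple of `c₁ - c₀`. -/
lemma coef_zero_of_left {l a b r c₀ c₁ c₂ : ℝ} {g : L2} (hl : l = a) (hab : a < b) (hr : b ≤ r)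
    (h1 : prim g a = 0) (h2 : prim₂ g a = 0)
    (hg : EqOn (prim₂ g) (quadSpline l a b r c₀ c₁ c₂) (Icc a b)) : c₀ = 0 ∧ c₁ = 0 := by
  subst hl
  have hd : 0 < b - l := sub_pos.2 hab
  have hp : HasDerivAt (quadSpline l l b r c₀ c₁ c₂) (2 * (c₁ - c₀) / (b - l)) l := by
    rw [funext (quadSpline_eq le_rfl hab hr c₀ c₁ c₂)]
    have := ((((hasDerivAt_id l).sub_const l).const_mul (2 * (c₁ - c₀) / (b - l))).const_add
      ((c₀ * (b - l) + c₁ * (l - l)) / (b - l))).add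
      ((((hasDerivAt_id l).sub_const l).pow 2).const_mul
        ((2 * (c₂ - c₁) / (r - l) - 2 * (c₁ - c₀) / (b - l)) / (b - l) / 2))
    convert! this using 1
    simp
  obtain ⟨v1, v2⟩ := HasDerivAt.eq_of_eqOn_Ioo hab ⟨le_rfl, hab.le⟩ (hasDerivAt_prim₂ g l) hp
    (hg.mono Ioo_subset_Icc_self)
  have e : quadSpline l l b r c₀ c₁ c₂ l = c₀ := by
    rw [quadSpline, sub_self, div_self hd.ne']
    simp
  rw [h2, e] at v1
  rw [h1] at v2
  have c0 : c₀ = 0 := v1.symm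
  refine ⟨c0, ?_⟩
  rw [c0] at v2
  field_simp at v2
  linarith

lemma coef_zero_of_right {l a b r c₀ c₁ c₂ : ℝ} {g : L2} (hl : l ≤ a) (hab : a < b) (hr : b = r)
    (h1 : prim g b = 0) (h2 : prim₂ g b = 0)
    (hg : EqOn (prim₂ g) (quadSpline l a b r c₀ c₁ c₂) (Icc a b)) : c₁ = 0 ∧ c₂ = 0 := by
  subst hr
  have hd : 0 < b - a := sub_pos.2 hab
  have hd2 : 0 < b - l := by linarith
  have hp : HasDerivAt (quadSpline l a b b c₀ c₁ c₂) (2 * (c₂ - c₁) / (b - a)) b := by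
    rw [funext (quadSpline_eq hl hab le_rfl c₀ c₁ c₂)]
    have := ((((hasDerivAt_id b).sub_const a).const_mul (2 * (c₁ - c₀) / (b - l))).const_add
      ((c₀ * (b - a) + c₁ * (a - l)) / (b - l))).add
      ((((hasDerivAt_id b).sub_const a).pow 2).const_mul
        ((2 * (c₂ - c₁) / (b - a) - 2 * (c₁ - c₀) / (b - l)) / (b - a) / 2))
    convert! this using 1
    simp only [id_eq]
    push_cast
    field_simp
    ring
  obtain ⟨v1, v2⟩ := HasDerivAt.eq_of_eqOn_Ioo hab ⟨hab.le, le_rfl⟩ (hasDerivAt_prim₂ g b) hp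
    (hg.mono Ioo_subset_Icc_self)
  have e : quadSpline l a b b c₀ c₁ c₂ b = c₂ := by
    rw [quadSpline, sub_self, div_self hd.ne']
    simp
  rw [h2, e] at v1
  rw [h1, ← v1] at v2
  refine ⟨?_, v1.symm⟩
  field_simp at v2
  linarith

/-- The middle coefficient is the polar form of the quadratic piece at `(a, b)`. -/
lemma quadSpline_midpoint {l a b r : ℝ} (hl : l ≤ a) (hab : a < b) (hr : b ≤ r)
    (c₀ c₁ c₂ : ℝ) :
    2 * quadSpline l a b r c₀ c₁ c₂ ((a + b) / 2)
      - (quadSpline l a b r c₀ c₁ c₂ a + quadSpline l a b r c₀ c₁ c₂ b) / 2 = c₁ := by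
  have h1 : b - a ≠ 0 := (sub_pos.2 hab).ne'
  have h2 : b - l ≠ 0 := (show 0 < b - l by linarith).ne'
  have h3 : r - a ≠ 0 := (show 0 < r - a by linarith).ne'
  rw [quadSpline, quadSpline, quadSpline]
  field_simp
  ring

/-- Reproduction of splines: interior coefficients are recovered by the polar form on one span, and
the two at each end vanish by the boundary conditions on value and slope. -/
lemma splineCoef_eq {n : ℕ} {ξ : ℕ → ℝ} (h : IsOpenKnotVector 2 (n + 2) ξ)
    (hs : ∀ j < n, ξ (j + 2) < ξ (j + 3)) (hn : 0 < n) {g : L2} (hg1 : prim g 1 = 0)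
    (hg2 : prim₂ g 1 = 0) {c : ℕ → ℝ}
    (hg : primL₂ g =ᵐ[mu] fun x => ∑ i ∈ Finset.range (n + 2), c i * bspline ξ 2 i x)
    {i : ℕ} (hi : i < n + 2) : splineCoef n ξ g i = c i := by
  by_cases hc : 2 ≤ i ∧ i < n
  · obtain ⟨j, rfl⟩ : ∃ j, i = j + 1 := ⟨i - 1, by omega⟩
    have hq := prim₂_eq_quadSpline h hs hg (show j < n by omega)
    have hab := hs j (by omega)
    rw [splineCoef, if_pos hc, greville]
    simp only [add_assoc, Nat.reduceAdd]
    rw [hq ⟨by linarith, by linarith⟩, hq ⟨le_rfl, hab.le⟩, hq ⟨hab.le, le_rfl⟩]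
    exact quadSpline_midpoint (h.mono _ (by omega)) hab (h.mono _ (by omega)) _ _ _
  · rw [splineCoef, if_neg hc]
    rcases lt_or_ge i 2 with h2 | h2
    · have hz := coef_zero_of_left (by rw [h.left 1 (by omega), h.left 2 le_rfl]) (hs 0 hn)
        (h.mono _ (by omega)) (by rw [h.left 2 le_rfl, prim_zero_right])
        (by rw [h.left 2 le_rfl, prim₂_zero_right]) (prim₂_eq_quadSpline h hs hg hn)
      interval_cases i
      · exact hz.1.symm
      · exact hz.2.symm
    · obtain ⟨m, rfl⟩ : ∃ m, n = m + 1 := ⟨n - 1, by omega⟩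
      have r1 : ξ (m + 3) = 1 := h.right _ (by omega) (by omega)
      have r2 : ξ (m + 4) = 1 := h.right _ (by omega) (by omega)
      have hz := coef_zero_of_right (h.mono _ (by omega)) (hs m (by omega))
        (by rw [r1, r2]) (by rw [r1, hg1]) (by rw [r1, hg2])
        (prim₂_eq_quadSpline h hs hg (show m < m + 1 by omega))
      obtain rfl | rfl : i = m + 1 ∨ i = m + 2 := by omega
      · exact hz.1.symm
      · exact hz.2.symm

lemma mem_splineSpace_of_ae_eq {N : ℕ} {ξ c : ℕ → ℝ} {u : L2}
    (hu : u =ᵐ[mu] fun x => ∑ i ∈ Finset.range N, c i * bspline ξ 2 i x) :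
    u ∈ splineSpace 2 N ξ := by
  refine ⟨∑ i ∈ Finset.range N, c i • bspline ξ 2 i, ?_, ?_⟩
  · refine Submodule.sum_mem _ fun i hi => Submodule.smul_mem _ _ (Submodule.subset_span ?_)
    exact ⟨⟨i, Finset.mem_range.1 hi⟩, rfl⟩
  · filter_upwards [hu] with x hx
    rw [hx, Finset.sum_apply]
    rfl

lemma exists_coef_of_mem_splineSpace {N : ℕ} {ξ : ℕ → ℝ} {u : L2} (hu : u ∈ splineSpace 2 N ξ) :
    ∃ c : ℕ → ℝ, u =ᵐ[mu] fun x => ∑ i ∈ Finset.range N, c i * bspline ξ 2 i x := by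
  obtain ⟨f, hf, huf⟩ := hu
  obtain ⟨a, rfl⟩ := (Submodule.mem_span_range_iff_exists_fun ℝ).1 hf
  refine ⟨fun i => if hi : i < N then a ⟨i, hi⟩ else 0, ?_⟩
  filter_upwards [huf] with x hx
  rw [hx, Finset.sum_apply, ← Fin.sum_univ_eq_sum_range
    (fun i => (if hi : i < N then a ⟨i, hi⟩ else 0) * bspline ξ 2 i x)]
  refine Finset.sum_congr rfl fun i _ => ?_
  simp

/-- The quasi-interpolation operator `H₀²(0,1) → S_{2,Ξ} ∩ H₀²(0,1)`. -/
def quasiInterpolant {n : ℕ} {ξ : ℕ → ℝ} (h : IsOpenKnotVector 2 (n + 2) ξ)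
    (hs : ∀ j < n, ξ (j + 2) < ξ (j + 3)) : sobolevZero 2 →ₗ[ℝ] sobolevZero 2 where
  toFun v := ⟨primL₂ (splineStep n ξ (splineCoef n ξ (weakDeriv 2 v))),
    have hm := splineStep_moments h hs
      (splineCoef_of_lt_two n ξ (weakDeriv 2 (v : L2)) (i := 0) (by omega))
      (splineCoef_of_lt_two n ξ (weakDeriv 2 (v : L2)) (i := 1) (by omega))
      (splineCoef_of_le n ξ (weakDeriv 2 (v : L2)) le_rfl)
      (splineCoef_of_le n ξ (weakDeriv 2 (v : L2)) (Nat.le_succ n))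
    primL₂_mem_sobolevZero hm.1 hm.2⟩
  map_add' u v := by
    refine Subtype.ext ?_
    change primL₂ (splineStep n ξ (splineCoef n ξ (weakDeriv 2 (u + v : L2)))) = _
    rw [weakDeriv_add u.2.1 v.2.1 2 le_rfl, splineCoef_add, splineStep_add, map_add]
    rfl
  map_smul' c v := by
    refine Subtype.ext ?_
    change primL₂ (splineStep n ξ (splineCoef n ξ (weakDeriv 2 (c • (v : L2))))) = _
    rw [weakDeriv_smul c v.2.1 2 le_rfl, splineCoef_smul, splineStep_smul, map_smul]
    rfl

section Projector

variable {n : ℕ} {ξ : ℕ → ℝ} (h : IsOpenKnotVector 2 (n + 2) ξ)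
  (hs : ∀ j < n, ξ (j + 2) < ξ (j + 3))

lemma coe_quasiInterpolant (v : sobolevZero 2) : (quasiInterpolant h hs v : L2)
    = primL₂ (splineStep n ξ (splineCoef n ξ (weakDeriv 2 v))) := rfl

lemma weakDeriv_quasiInterpolant (v : sobolevZero 2) :
    HasWeakDeriv 2 (quasiInterpolant h hs v) (splineStep n ξ (splineCoef n ξ (weakDeriv 2 v))) := by
  obtain ⟨m1, m2⟩ := splineStep_moments h hs
      (splineCoef_of_lt_two n ξ (weakDeriv 2 (v : L2)) (i := 0) (by omega))
      (splineCoef_of_lt_two n ξ (weakDeriv 2 (v : L2)) (i := 1) (by omega))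
      (splineCoef_of_le n ξ (weakDeriv 2 (v : L2)) le_rfl)
      (splineCoef_of_le n ξ (weakDeriv 2 (v : L2)) (Nat.le_succ n))
  exact (hasWeakDeriv_primL₂ m1 m2).2

lemma quasiInterpolant_ae_eq (v : sobolevZero 2) : (quasiInterpolant h hs v : L2) =ᵐ[mu]
    fun x => ∑ i ∈ Finset.range (n + 2), splineCoef n ξ (weakDeriv 2 v) i * bspline ξ 2 i x := by
  rw [coe_quasiInterpolant]
  filter_upwards [primL₂_ae_eq (splineStep n ξ (splineCoef n ξ (weakDeriv 2 v))),
    ae_restrict_mem measurableSet_Ioo] with x hx hx'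
  rw [hx, prim₂_splineStep_eq_sum h hs (splineCoef_of_lt_two n ξ _ (by omega))
    (splineCoef_of_lt_two n ξ _ (by omega)) (Ioo_subset_Ico_self hx')]

lemma isProj_quasiInterpolant (hn : 0 < n) : LinearMap.IsProj
    ((splineSpace 2 (n + 2) ξ).comap (sobolevZero 2).subtype) (quasiInterpolant h hs) := by
  constructor
  · intro v
    exact mem_splineSpace_of_ae_eq (quasiInterpolant_ae_eq h hs v)
  · intro v hv
    obtain ⟨c, hc⟩ := exists_coef_of_mem_splineSpace (u := (v : L2)) hv
    obtain ⟨e, m1, m2⟩ := eq_primL₂_of_mem_sobolevZero v.2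
    have hc' := hc
    rw [e] at hc'
    refine Subtype.ext (Lp.ext ?_)
    filter_upwards [quasiInterpolant_ae_eq h hs v, hc] with x h1 h2
    rw [h1, h2]
    refine Finset.sum_congr rfl fun i hi => ?_
    rw [splineCoef_eq h hs hn m1 m2 hc' (Finset.mem_range.1 hi)]

lemma quasiInterpolant_estimates {cQ H : ℝ} (hcQ : 0 < cQ)
    (hH : ∀ i < n + 4, ξ (i + 1) - ξ i ≤ H) (hq : ∀ j < n, cQ * H ≤ ξ (j + 3) - ξ (j + 2))
    (v : sobolevZero 2) :
    sobolevSeminorm 2 (quasiInterpolant h hs v) ^ 2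
        + sobolevSeminorm 2 (v - quasiInterpolant h hs v) ^ 2
        ≤ (2 + 3 * (3456 / cQ ^ 3)) * sobolevSeminorm 2 v ^ 2 ∧
      ‖(v : L2) - quasiInterpolant h hs v‖ ^ 2 ≤ 114 * H ^ 4 * sobolevSeminorm 2 v ^ 2 := by
  obtain ⟨e, m1, m2⟩ := eq_primL₂_of_mem_sobolevZero v.2
  constructor
  · have hw := weakDeriv_quasiInterpolant h hs v
    have hv : HasWeakDeriv 2 (v : L2) (weakDeriv 2 v) := by
      obtain ⟨g, hg⟩ := v.2.1 2 le_rfl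
      rwa [hg.weakDeriv_eq]
    have hd := (hv.add (hw.smul (-1))).weakDeriv_eq
    rw [neg_one_smul, neg_one_smul, ← sub_eq_add_neg, ← sub_eq_add_neg] at hd
    rw [sobolevSeminorm, sobolevSeminorm, sobolevSeminorm, hw.weakDeriv_eq, hd]
    have hG := norm_splineStep_sq_le h hs hH m1 m2 hcQ hq
    set g := weakDeriv 2 (v : L2)
    set G := splineStep n ξ (splineCoef n ξ g)
    have ht := pow_le_pow_left₀ (norm_nonneg _) (norm_sub_le g G) 2
    -- Since `‖g - G‖ ^ 2 ≤ 2 * ‖g‖ ^ 2 + 2 * ‖G‖ ^ 2`, the sum is at most `2 * ‖g‖ ^ 2 + 3 * ‖G‖ ^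
    -- 2`.
    nlinarith [sq_nonneg (‖g‖ - ‖G‖)]
  · rw [coe_quasiInterpolant, sobolevSeminorm]
    have := norm_primL₂_sub_sq_le h hs hH m1 m2
    rwa [← e] at this

end Projector

/-! ### Knot spans and the number of B-splines. -/

lemma sub_le_maxKnotSpan {p N : ℕ} {ξ : ℕ → ℝ} (h : IsOpenKnotVector p N ξ) {i : ℕ}
    (hi : i < N + p) : ξ (i + 1) - ξ i ≤ maxKnotSpan p N ξ := by
  refine le_csSup ⟨1, ?_⟩ ⟨i, hi, rfl⟩
  rintro _ ⟨k, hk, rfl⟩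
  linarith [(h.mem_Icc (show k + 1 ≤ N + p by omega)).2, (h.mem_Icc hk.le).1]

lemma minKnotSpan_le {p N : ℕ} {ξ : ℕ → ℝ} {i : ℕ} (hi : i < N + p) (hlt : ξ i < ξ (i + 1)) :
    minKnotSpan p N ξ ≤ ξ (i + 1) - ξ i := by
  refine csInf_le ⟨0, ?_⟩ ⟨i, hi, hlt, rfl⟩
  rintro _ ⟨k, -, hk, rfl⟩
  linarith

lemma IsOpenKnotVector.two_lt {N : ℕ} {ξ : ℕ → ℝ} (h : IsOpenKnotVector 2 N ξ) : 2 < N := by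
  by_contra hN
  have h1 := h.left 2 le_rfl
  have h2 := h.right 2 (by omega) (by omega)
  linarith

end UnitInterval

end

open UnitInterval
theorem lemma4p2 (cQ : ℝ) (hcQ : 0 < cQ) :
    ∃ C : ℝ, 0 < C ∧
      ∀ (N : ℕ) (ξ : ℕ → ℝ),
        IsOpenKnotVector 2 N ξ →
        maxKnotSpan 2 N ξ ≤ 1 / 4 →
        cQ * maxKnotSpan 2 N ξ ≤ minKnotSpan 2 N ξ →
        splineSpace 2 N ξ ≤ sobolev 2 →
        ∃ P : sobolevZero 2 →ₗ[ℝ] sobolevZero 2,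
          LinearMap.IsProj ((splineSpace 2 N ξ).comap (sobolevZero 2).subtype) P ∧
          ∀ v : sobolevZero 2,
            sobolevSeminorm 2 (P v) ^ 2 + sobolevSeminorm 2 (v - P v) ^ 2
                ≤ C * sobolevSeminorm 2 v ^ 2 ∧
            ‖(v : L2) - P v‖ ^ 2
                ≤ C * maxKnotSpan 2 N ξ ^ 4 * sobolevSeminorm 2 v ^ 2 := by
  -- One constant for both estimates: `114` serves the `L²` bound and exceeds the `2` of the
  -- stability bound.
  refine ⟨114 + 3 * (3456 / cQ ^ 3), by positivity, fun N ξ h _ hq hS => ?_⟩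
  obtain ⟨n, rfl⟩ : ∃ n, N = n + 2 := ⟨N - 2, by have := h.two_lt; omega⟩
  have hn : 0 < n := by have := h.two_lt; omega
  have hs : ∀ j < n, ξ (j + 2) < ξ (j + 3) := fun j hj => knot_lt_succ h hS hj
  have hQ : (0 : ℝ) ≤ 3 * (3456 / cQ ^ 3) := by positivity
  refine ⟨quasiInterpolant h hs, isProj_quasiInterpolant h hs hn, fun v => ?_⟩
  obtain ⟨h1, h2⟩ := quasiInterpolant_estimates h hs hcQ (fun i hi => sub_le_maxKnotSpan h hi)
    (fun j hj => hq.trans (minKnotSpan_le (by omega) (hs j hj))) v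
  refine ⟨h1.trans ?_, h2.trans ?_⟩
  · gcongr
    norm_num
  · gcongr
    linarith
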